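/- **Setting.** Let $\Omega\subset\mathbb R^2$ be a bounded open set whose closure is the union of the closed triangles $\overline{\Omega^e}$, $e=1,\dots,nel$, of a conforming triangulation with open, pairwise disjoint elements $\Omega^e\subset\Omega$ of diameter $h_{\Omega^e}$. Let $\varepsilon>0$ and $\pi_1>0$. Let $u\in H^1_0(\Omega)^2$ with $\nabla\cdot u=0$. Let $D_\omega$ be Lipschitz on each element with $D_\omega\ge 1$ a.e. in $\Omega$. Let $X_h$ be the space of continuous functions on $\overline\Omega$ that are polynomials of degree at most $2$ on each element, and let $V_h=\{\varphi\in X_h: u\cdot\nabla\varphi\in L^2(\Omega)\}$. Write $(\cdot,\cdot)$ and $\|\cdot\|_2$ for the inner product and norm of $L^2(\Omega)$. For weights $\delta_{\Omega^e}\ge 0$ put $$a^\varepsilon_{\rm supg}(\phi,\psi)=(u\cdot\nabla\phi,\psi)+\pi_1(D_\omega\nabla\phi,\nabla\psi)+\varepsilon(\phi,\psi)+\sum_{e}\int_{\Omega^e}\delta_{\Omega^e}\bigl(u\cdot\nabla\phi+\varepsilon\phi-\pi_1\nabla\cdot(D_\omega\nabla\phi)\bigr)(u\cdot\nabla\psi),$$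 $$\|\varphi\|_{\rm supg}^2=\pi_1\|\nabla\varphi\|_2^2+\varepsilon\|\varphi\|_2^2+\sum_e\|\delta_{\Omega^e}^{1/2}\,u\cdot\nabla\varphi\|_{2,\Omega^e}^2 ,$$ and, for $\pi_2\in\mathbb R$, $\theta_h\in X_h$ and $D_\theta$ Lipschitz on each element, $$b_{\rm supg}(\psi)=\pi_2(D_\theta\nabla\theta_h,\nabla\psi)+\sum_e\int_{\Omega^e}\delta_{\Omega^e}\,\pi_2\,\nabla\cdot(D_\theta\nabla\theta_h)\,(u\cdot\nabla\psi).$$ Let $C_{inv}>0$ be a constant in the inverse inequality $$\|\nabla\cdot(D_\omega\nabla\varphi)\|_{2,\Omega^e}\le \frac{C_{inv}}{h_{\Omega^e}}\,\|D_\omega\|_{\infty,\Omega^e}\,\|\nabla\varphi\|_{2,\Omega^e}\qquad\text{for all }\varphi\in X_h\text{ and all }e$$ (for $D_\omega$ constant on each element this reads $\|\Delta\varphi\|_{2,\Omega^e}\le C_{inv}h_{\Omega^e}^{-1}\|\nabla\varphi\|_{2,\Omega^e}$). **Theorem (SUPG Lax–Milgram conditions).** Such a constant $C_{inv}$ exists.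 Suppose that for every element $$0\le\delta_{\Omega^e}\le\min\left\{\frac1{2\varepsilon},\ \frac{h_{\Omega^e}^2}{2\,\pi_1\,\|D_\omega\|_{\infty,\Omega^e}^2\,C_{inv}^2}\right\}.$$ Then $a^\varepsilon_{\rm supg}$ is bilinear on $V_h$, and for all $\varphi,\psi\in V_h$ $$a^\varepsilon_{\rm supg}(\varphi,\varphi)\ge\tfrac12\|\varphi\|_{\rm supg}^2,\qquad |a^\varepsilon_{\rm supg}(\varphi,\psi)|\le C\,\|\varphi\|_{\rm supg}\|\psi\|_{\rm supg},$$ where $C$ depends only on $\varepsilon$, $\pi_1$ and upper bounds for $\|D_\omega\|_{\infty,\Omega}$ and $\|u\|_{H^1(\Omega)}$ (in particular not on the mesh, the weights, or $C_{inv}$). Hence the discrete problem is well-posed: every linear functional $\ell$ on $V_h$ is bounded for $\|\cdot\|_{\rm supg}$; there is exactly one $\phi_h\in V_h$ with $a^\varepsilon_{\rm supg}(\phi_h,\psi)=\ell(\psi)$ for all $\psi\in V_h$; and $\|\phi_h\|_{\rm supg}\le 2M$ whenever $M\ge0$ and $|\ell(\psi)|\le M\|\psi\|_{\rm supg}$ for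 all $\psi\in V_h$. In particular $b_{\rm supg}$ is a linear functional on $V_h$, and the stabilized discrete nanoparticle problem $a^\varepsilon_{\rm supg}(\phi_h,\psi)=b_{\rm supg}(\psi)$ for all $\psi\in V_h$ has exactly one solution $\phi_h\in V_h$. -/

import Mathlib

open MeasureTheory Set
open scoped ContDiff

/-- The Euclidean plane. -/
abbrev Plane : Type := EuclideanSpace ℝ (Fin 2)

/-- A conforming triangulation of a (polygonal) plane domain `Ω` into finitely many triangles. -/
structure Triangulation (Ω : Set Plane) where
  /-- the number of elements -/
  nel : ℕ
  /-- the three vertices of each element -/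
  vert : Fin nel → Fin 3 → Plane
  nondegenerate : ∀ e, AffineIndependent ℝ (vert e)
  cover : closure Ω = ⋃ e, convexHull ℝ (range (vert e))
  interior_subset : ∀ e, interior (convexHull ℝ (range (vert e))) ⊆ Ω
  disjoint_interior : ∀ e e', e ≠ e' →
    Disjoint (interior (convexHull ℝ (range (vert e)))) (interior (convexHull ℝ (range (vert e'))))
  conforming : ∀ e e', e ≠ e' →
    convexHull ℝ (range (vert e)) ∩ convexHull ℝ (range (vert e')) =
      convexHull ℝ (range (vert e) ∩ range (vert e'))

namespace Triangulation

variable {Ω : Set Plane} (T : Triangulation Ω)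

/-- The (open) element `Ωᵉ`. -/
def elem (e : Fin T.nel) : Set Plane := interior (convexHull ℝ (range (T.vert e)))

/-- The element size `h_{Ωᵉ}`: the diameter of the element. -/
noncomputable def size (e : Fin T.nel) : ℝ := Metric.diam (T.elem e)

/-- A predicate which holds at every point of every element holds almost everywhere in `Ω`. -/
theorem ae_of_forall_elem {p : Plane → Prop} (hp : ∀ e, ∀ x ∈ T.elem e, p x) :
    ∀ᵐ x ∂(volume.restrict Ω), p x := by
  have hnull : volume (⋃ e, frontier (convexHull ℝ (range (T.vert e)))) = 0 := by
    rw [measure_iUnion_null_iff]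
    intro e
    exact (convex_convexHull ℝ _).addHaar_frontier volume
  have h1 : ∀ᵐ x ∂(volume.restrict Ω), x ∉ ⋃ e, frontier (convexHull ℝ (range (T.vert e))) :=
    ae_restrict_of_ae (measure_eq_zero_iff_ae_notMem.1 hnull)
  have h2 : ∀ᵐ x ∂(volume.restrict Ω), x ∈ closure Ω :=
    ae_restrict_of_ae_restrict_of_subset subset_closure
      (ae_restrict_mem isClosed_closure.measurableSet)
  filter_upwards [h1, h2] with x hx1 hx2
  rw [T.cover] at hx2
  obtain ⟨e, he⟩ := mem_iUnion.1 hx2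
  refine hp e x ?_
  by_contra hni
  exact hx1 (mem_iUnion.2 ⟨e, subset_closure he, hni⟩)

/-- The space `X_h` of continuous functions on the closure of `Ω` which are polynomials of total
degree at most two on every element. A function on the closure of `Ω` is represented by its
extension by zero to the plane, so that equality in `X_h` is equality on the closure of `Ω`. -/
def P2Space : Submodule ℝ (Plane → ℝ) where
  carrier := {φ | ContinuousOn φ (closure Ω) ∧ (∀ x ∉ closure Ω, φ x = 0) ∧
    ∀ e, ∃ p : MvPolynomial (Fin 2) ℝ, p.totalDegree ≤ 2 ∧
      ∀ x ∈ T.elem e, φ x = MvPolynomial.eval (fun i => x i) p}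
  zero_mem' := ⟨continuousOn_const, fun _ _ => rfl, fun _ => ⟨0, by simp, fun _ _ => by simp⟩⟩
  add_mem' := by
    rintro φ ψ ⟨h1, h2, h3⟩ ⟨k1, k2, k3⟩
    refine ⟨h1.add k1, fun x hx => by simp [h2 x hx, k2 x hx], fun e => ?_⟩
    obtain ⟨p, hp, hp'⟩ := h3 e
    obtain ⟨q, hq, hq'⟩ := k3 e
    exact ⟨p + q, (MvPolynomial.totalDegree_add p q).trans (max_le hp hq),
      fun x hx => by simp [hp' x hx, hq' x hx]⟩
  smul_mem' := by
    rintro c φ ⟨h1, h2, h3⟩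
    refine ⟨h1.const_smul c, fun x hx => by simp [h2 x hx], fun e => ?_⟩
    obtain ⟨p, hp, hp'⟩ := h3 e
    exact ⟨c • p, (MvPolynomial.totalDegree_smul_le c p).trans hp,
      fun x hx => by simp [hp' x hx, MvPolynomial.smul_eval]⟩

theorem differentiableAt_of_mem {φ : Plane → ℝ} (hφ : φ ∈ T.P2Space) (e : Fin T.nel)
    (x : Plane) (hx : x ∈ T.elem e) : DifferentiableAt ℝ φ x := by
  obtain ⟨p, -, hp⟩ := hφ.2.2 e
  have hev : φ =ᶠ[nhds x] fun y => MvPolynomial.eval (fun i => y i) p :=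
    Filter.eventually_of_mem (isOpen_interior.mem_nhds hx) hp
  refine DifferentiableAt.congr_of_eventuallyEq ?_ hev
  clear hev hp hφ
  induction p using MvPolynomial.induction_on with
  | C a => simp
  | add p q hp hq =>
    simp only [map_add]
    exact DifferentiableAt.fun_add hp hq
  | mul_X p i hp =>
    have : DifferentiableAt ℝ (fun y : Plane => y i) x := by fun_prop
    simp only [map_mul, MvPolynomial.eval_X]
    exact DifferentiableAt.fun_mul hp this

/-- The space `V_h = {φ ∈ X_h : u · ∇φ ∈ L²(Ω)}`. The gradient of `φ ∈ X_h` is the classical one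
inside every element, hence is defined almost everywhere in `Ω`. -/
noncomputable def supgSpace (u : Plane → Plane) : Submodule ℝ (Plane → ℝ) where
  carrier := {φ | φ ∈ T.P2Space ∧
    MemLp (fun x => inner ℝ (u x) (gradient φ x)) 2 (volume.restrict Ω)}
  zero_mem' := ⟨T.P2Space.zero_mem, by
    have : (fun x => inner ℝ (u x) (gradient (0 : Plane → ℝ) x)) = fun _ => (0 : ℝ) := by
      funext x
      simp [gradient]
    rw [this]
    exact MemLp.zero'⟩
  add_mem' := by
    rintro φ ψ ⟨h1, h2⟩ ⟨k1, k2⟩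
    refine ⟨T.P2Space.add_mem h1 k1, (memLp_congr_ae ?_).1 (h2.add k2)⟩
    refine T.ae_of_forall_elem fun e x hx => ?_
    have ha := T.differentiableAt_of_mem h1 e x hx
    have hb := T.differentiableAt_of_mem k1 e x hx
    simp [gradient, fderiv_add ha hb, inner_add_right]
  smul_mem' := by
    rintro c φ ⟨h1, h2⟩
    refine ⟨T.P2Space.smul_mem c h1, (memLp_congr_ae ?_).1 (h2.const_smul c)⟩
    refine T.ae_of_forall_elem fun e x hx => ?_
    have ha := T.differentiableAt_of_mem h1 e x hx
    simp [gradient, fderiv_const_smul ha, inner_smul_right]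

end Triangulation

/-- Test functions: smooth with compact support in `Ω`. -/
def IsTestFunction (Ω : Set Plane) (η : Plane → ℝ) : Prop :=
  ContDiff ℝ ∞ η ∧ HasCompactSupport η ∧ tsupport η ⊆ Ω

/-- `g` is the weak gradient of `v` on `Ω`. -/
def HasWeakGradient (Ω : Set Plane) (v : Plane → ℝ) (g : Plane → Plane) : Prop :=
  ∀ η : Plane → ℝ, IsTestFunction Ω η → ∀ i : Fin 2,
    ∫ x in Ω, v x * gradient η x i = -∫ x in Ω, g x i * η x

/-- `v ∈ H¹(Ω)`, with weak gradient `g`. -/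
structure MemH1 (Ω : Set Plane) (v : Plane → ℝ) (g : Plane → Plane) : Prop where
  memLp : MemLp v 2 (volume.restrict Ω)
  memLp_grad : MemLp g 2 (volume.restrict Ω)
  weakGradient : HasWeakGradient Ω v g

/-- `v ∈ H¹₀(Ω)`, with weak gradient `g`: the function `v` lies in the closure of the test
functions in `H¹(Ω)`. -/
structure MemH10 (Ω : Set Plane) (v : Plane → ℝ) (g : Plane → Plane) : Prop
    extends MemH1 Ω v g where
  approx : ∀ r : ENNReal, 0 < r → ∃ η : Plane → ℝ, IsTestFunction Ω η ∧
    eLpNorm (fun x => η x - v x) 2 (volume.restrict Ω) ≤ r ∧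
    eLpNorm (fun x => gradient η x - g x) 2 (volume.restrict Ω) ≤ r

/-- `u ∈ H¹₀(Ω) × H¹₀(Ω)` with `∇ · u = 0`; here `G i` is the weak gradient of `uᵢ`. -/
structure IsVelocity (Ω : Set Plane) (u : Plane → Plane) (G : Fin 2 → Plane → Plane) : Prop where
  memH10 : ∀ i, MemH10 Ω (fun x => u x i) (G i)
  divFree : ∀ᵐ x ∂(volume.restrict Ω), ∑ i, G i x i = 0

/-- The norm of `u` in `H¹(Ω) × H¹(Ω)`, where `G i` is the weak gradient of `uᵢ`. -/
noncomputable def velocityNorm (Ω : Set Plane) (u : Plane → Plane) (G : Fin 2 → Plane → Plane) :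
    ℝ :=
  √((∫ x in Ω, ‖u x‖ ^ 2) + ∑ i, ∫ x in Ω, ‖G i x‖ ^ 2)

/-- The norm of `L^∞(S)`. -/
noncomputable def supNorm (S : Set Plane) (D : Plane → ℝ) : ℝ :=
  (eLpNorm D ⊤ (volume.restrict S)).toReal

/-- `∇ · (D ∇φ)` at a point. -/
noncomputable def divDGrad (D φ : Plane → ℝ) (x : Plane) : ℝ :=
  ∑ i : Fin 2, fderiv ℝ (fun y => D y * gradient φ y i) x (EuclideanSpace.single i 1)

namespace Triangulation

variable {Ω : Set Plane} (T : Triangulation Ω)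

/-- `D` is Lipschitz (that is, of class `W^{1,∞}`) on every element. -/
def ElementwiseLipschitz (D : Plane → ℝ) : Prop :=
  ∀ e, ∃ L, LipschitzOnWith L D (T.elem e)

/-- `C > 0` is a constant for the inverse inequality
`‖∇ · (D ∇φ)‖_{2,Ωᵉ} ≤ (C / h_{Ωᵉ}) ‖D‖_{∞,Ωᵉ} ‖∇φ‖_{2,Ωᵉ}` for all `φ ∈ X_h` and all elements.
For `D` constant on each element this is `‖Δφ‖_{2,Ωᵉ} ≤ (C / h_{Ωᵉ}) ‖∇φ‖_{2,Ωᵉ}`. -/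
def IsInverseConstant (D : Plane → ℝ) (C : ℝ) : Prop :=
  0 < C ∧ ∀ φ ∈ T.P2Space, ∀ e,
    √(∫ x in T.elem e, divDGrad D φ x ^ 2) ≤
      C / T.size e * supNorm (T.elem e) D * √(∫ x in T.elem e, ‖gradient φ x‖ ^ 2)

/-- The form `a^ε(φ,ψ) = (u·∇φ, ψ) + π₁ (D ∇φ, ∇ψ) + ε (φ, ψ)`. -/
noncomputable def galerkinForm (Ω : Set Plane) (u : Plane → Plane) (D : Plane → ℝ) (ε π₁ : ℝ)
    (φ ψ : Plane → ℝ) : ℝ :=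
  (∫ x in Ω, inner ℝ (u x) (gradient φ x) * ψ x)
    + π₁ * (∫ x in Ω, D x * inner ℝ (gradient φ x) (gradient ψ x))
    + ε * ∫ x in Ω, φ x * ψ x

/-- The stabilized form
`a^ε_supg(φ,ψ) = a^ε(φ,ψ) + Σₑ ∫_{Ωᵉ} δₑ (u·∇φ + ε φ - π₁ ∇·(D ∇φ)) (u·∇ψ)`. -/
noncomputable def supgForm (u : Plane → Plane) (D : Plane → ℝ) (δ : Fin T.nel → ℝ) (ε π₁ : ℝ)
    (φ ψ : Plane → ℝ) : ℝ :=
  galerkinForm Ω u D ε π₁ φ ψ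
    + ∑ e, ∫ x in T.elem e, δ e *
        (inner ℝ (u x) (gradient φ x) + ε * φ x - π₁ * divDGrad D φ x) *
        inner ℝ (u x) (gradient ψ x)

/-- The right-hand side
`b_supg(ψ) = π₂ (D_θ ∇θ, ∇ψ) + Σₑ ∫_{Ωᵉ} δₑ π₂ ∇·(D_θ ∇θ) (u·∇ψ)`. -/
noncomputable def supgLoad (u : Plane → Plane) (Dθ θ : Plane → ℝ) (δ : Fin T.nel → ℝ) (π₂ : ℝ)
    (ψ : Plane → ℝ) : ℝ :=
  π₂ * (∫ x in Ω, Dθ x * inner ℝ (gradient θ x) (gradient ψ x))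
    + ∑ e, ∫ x in T.elem e, δ e * π₂ * divDGrad Dθ θ x * inner ℝ (u x) (gradient ψ x)

/-- The norm `‖φ‖_supg`, with
`‖φ‖²_supg = π₁ ‖∇φ‖₂² + ε ‖φ‖₂² + Σₑ ‖δₑ^{1/2} u·∇φ‖²_{2,Ωᵉ}`. -/
noncomputable def supgNorm (u : Plane → Plane) (δ : Fin T.nel → ℝ) (ε π₁ : ℝ)
    (φ : Plane → ℝ) : ℝ :=
  √(π₁ * (∫ x in Ω, ‖gradient φ x‖ ^ 2) + ε * (∫ x in Ω, φ x ^ 2)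
    + ∑ e, ∫ x in T.elem e, (√(δ e) * inner ℝ (u x) (gradient φ x)) ^ 2)

end Triangulation

/-! ### Lipschitz functions on finite closed covers -/

/-- A function of one real variable which is Lipschitz on each of finitely many closed sets
covering an interval satisfies the Lipschitz estimate at the end points of the interval. -/
theorem dist_le_of_finite_closed_cover {ι : Type*} {g : ℝ → ℝ} {L : ℝ} {F : ι → Set ℝ}
    (hF : ∀ i, IsClosed (F i))
    (hlip : ∀ i, ∀ x ∈ F i, ∀ y ∈ F i, dist (g x) (g y) ≤ L * dist x y) (s : Finset ι) :
    ∀ a b, a ≤ b → Icc a b ⊆ ⋃ i ∈ s, F i → dist (g a) (g b) ≤ L * (b - a) := by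
  classical
  induction s using Finset.strongInduction with
  | H s ih =>
    intro a b hab hcov
    obtain ⟨i, his, hai⟩ := mem_iUnion₂.1 (hcov (left_mem_Icc.2 hab))
    have hcl : IsClosed (F i ∩ Icc a b) := (hF i).inter isClosed_Icc
    have hne : (F i ∩ Icc a b).Nonempty := ⟨a, hai, left_mem_Icc.2 hab⟩
    have hbdd : BddAbove (F i ∩ Icc a b) := ⟨b, fun x hx => hx.2.2⟩
    set t := sSup (F i ∩ Icc a b) with ht
    have htm : t ∈ F i ∩ Icc a b := hcl.csSup_mem hne hbdd
    have h1 : dist (g a) (g t) ≤ L * (t - a) := by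
      have := hlip i a hai t htm.1
      rwa [Real.dist_eq a t, abs_sub_comm, abs_of_nonneg (sub_nonneg.2 htm.2.1)] at this
    rcases htm.2.2.eq_or_lt with h | h
    · rwa [h] at h1
    have hsub : Ioo t b ⊆ ⋃ j ∈ s.erase i, F j := by
      intro x hx
      have hxI : x ∈ Icc a b := ⟨htm.2.1.trans hx.1.le, hx.2.le⟩
      obtain ⟨j, hjs, hxj⟩ := mem_iUnion₂.1 (hcov hxI)
      refine mem_iUnion₂.2 ⟨j, Finset.mem_erase.2 ⟨?_, hjs⟩, hxj⟩
      rintro rfl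
      exact absurd (le_csSup hbdd ⟨hxj, hxI⟩) (not_le.2 hx.1)
    have hcl' : IsClosed (⋃ j ∈ s.erase i, F j) := isClosed_biUnion_finset fun j _ => hF j
    have hsub' : Icc t b ⊆ ⋃ j ∈ s.erase i, F j := by
      rw [← closure_Ioo h.ne]
      exact closure_minimal hsub hcl'
    have h2 := ih _ (Finset.erase_ssubset his) t b htm.2.2 hsub'
    calc dist (g a) (g b) ≤ dist (g a) (g t) + dist (g t) (g b) := dist_triangle _ _ _
      _ ≤ L * (t - a) + L * (b - t) := add_le_add h1 h2
      _ = L * (b - a) := by ring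

/-- A function on a normed space which is Lipschitz on each member of a finite closed cover is
Lipschitz. -/
theorem lipschitzWith_of_finite_closed_cover {E ι : Type*} [NormedAddCommGroup E]
    [NormedSpace ℝ E] [Fintype ι] {f : E → ℝ} {C : NNReal} {S : ι → Set E}
    (hS : ∀ i, IsClosed (S i)) (hcov : ⋃ i, S i = univ) (hlip : ∀ i, LipschitzOnWith C f (S i)) :
    LipschitzWith C f := by
  refine LipschitzWith.of_dist_le_mul fun x y => ?_
  set l : ℝ → E := fun t => x + t • (y - x) with hl
  have hlc : Continuous l := by fun_prop
  have hd : ∀ s t, dist (l s) (l t) = dist s t * dist x y := by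
    intro s t
    rw [dist_eq_norm, dist_comm x y, dist_eq_norm y x, Real.dist_eq, ← Real.norm_eq_abs,
      ← norm_smul]
    congr 1
    simp only [hl, sub_smul]
    abel
  have := dist_le_of_finite_closed_cover (g := f ∘ l) (L := C * dist x y) (F := fun i => l ⁻¹' S i)
    (fun i => (hS i).preimage hlc)
    (fun i s hs t ht => by
      refine ((hlip i).dist_le_mul _ hs _ ht).trans (le_of_eq ?_)
      rw [hd]
      ring) Finset.univ 0 1 zero_le_one
    (by
      intro t _
      have : l t ∈ ⋃ i, S i := hcov ▸ mem_univ _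
      simpa using this)
  simpa [hl] using this

/-! ### A Sobolev inequality for Lipschitz functions in the plane -/

theorem LipschitzWith.enorm_le_lintegral_deriv {g : ℝ → ℝ} {C : NNReal} (hg : LipschitzWith C g)
    (hc : HasCompactSupport g) (x : ℝ) : ‖g x‖ₑ ≤ ∫⁻ y, ‖deriv g y‖ₑ := by
  obtain ⟨R, hR⟩ := hc.isCompact.bddBelow
  set a := min x (R - 1) with ha
  have hga : g a = 0 := by
    by_contra h
    have h1 : R ≤ a := hR (subset_tsupport _ h)
    have h2 : a ≤ R - 1 := min_le_right _ _
    linarith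
  have hax : a ≤ x := min_le_left _ _
  have h := ((hg.lipschitzOnWith (s := uIcc a x)).absolutelyContinuousOnInterval).integral_deriv_eq_sub
  rw [hga, sub_zero, intervalIntegral.integral_of_le hax] at h
  rw [← h]
  exact (enorm_integral_le_lintegral_enorm _).trans
    (lintegral_mono' Measure.restrict_le_self le_rfl)

/-- The **Gagliardo–Nirenberg–Sobolev inequality** in the plane for Lipschitz functions with
compact support. -/
theorem LipschitzWith.lintegral_sq_le_sq_lintegral_lineDeriv {f : Plane → ℝ} {C : NNReal}
    (hf : LipschitzWith C f) (hc : HasCompactSupport f) :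
    ∫⁻ x, ‖f x‖ₑ ^ 2 ≤
      (∫⁻ x, ∑ i : Fin 2, ‖lineDeriv ℝ f x (EuclideanSpace.single i 1)‖ₑ) ^ 2 := by
  set e := MeasurableEquiv.toLp 2 (Fin 2 → ℝ)
  have he : MeasurePreserving e volume volume :=
    (EuclideanSpace.volume_preserving_symm_measurableEquiv_toLp (Fin 2)).symm
  set F : Plane → ENNReal :=
    fun x => ∑ i : Fin 2, ‖lineDeriv ℝ f x (EuclideanSpace.single i 1)‖ₑ with hF
  have hFm : Measurable F :=
    Finset.measurable_sum _ fun i _ => (measurable_lineDeriv hf.continuous).enorm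
  rw [← he.lintegral_comp_emb e.measurableEmbedding, ← he.lintegral_comp_emb e.measurableEmbedding]
  have hup : ∀ (x : Fin 2 → ℝ) (i : Fin 2) (t s : ℝ), e (Function.update x i (t + s)) =
      e (Function.update x i t) + s • EuclideanSpace.single i 1 := by
    intro x i t s
    ext j
    rcases eq_or_ne j i with rfl | hj <;> simp [e, *]
  have hup' : ∀ (x : Fin 2 → ℝ) (i : Fin 2) (t : ℝ), e (Function.update x i t) =
      e (Function.update x i 0) + t • EuclideanSpace.single i 1 := by
    intro x i t
    rw [← hup, zero_add]
  have key : ∀ (x : Fin 2 → ℝ) (i : Fin 2),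
      ‖f (e x)‖ₑ ≤ ∫⁻ t, F (e (Function.update x i t)) := by
    intro x i
    set g : ℝ → ℝ := fun t => f (e (Function.update x i t)) with hg
    have hiso : Isometry fun t : ℝ => e (Function.update x i t) := by
      refine Isometry.of_dist_eq fun s t => ?_
      rw [hup' x i s, hup' x i t, dist_add_left, dist_eq_norm, ← sub_smul, norm_smul]
      simp [Real.dist_eq]
    have hgl : LipschitzWith C g := by
      have := hf.comp hiso.lipschitz
      rwa [mul_one] at this
    have hgc : HasCompactSupport g := hc.comp_isClosedEmbedding hiso.isClosedEmbedding
    have h1 := hgl.enorm_le_lintegral_deriv hgc (x i)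
    have h2 : g (x i) = f (e x) := by simp [hg]
    rw [h2] at h1
    refine h1.trans (lintegral_mono fun t => ?_)
    have h3 : deriv g t =
        lineDeriv ℝ f (e (Function.update x i t)) (EuclideanSpace.single i 1) := by
      rw [lineDeriv]
      simp_rw [← hup]
      have := deriv_comp_const_add (f := g) t 0
      rw [add_zero] at this
      exact this.symm
    rw [h3, hF]
    exact Finset.single_le_sum
      (f := fun j => ‖lineDeriv ℝ f (e (Function.update x i t)) (EuclideanSpace.single j 1)‖ₑ)
      (fun _ _ => zero_le) (Finset.mem_univ i)
  have hgrid := lintegral_prod_lintegral_pow_le (ι := Fin 2) (A := fun _ => ℝ)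
    (fun _ => volume) (p := 2) (by simpa using Real.HolderConjugate.two_two)
    (f := fun x => F (e x)) (hFm.comp e.measurable)
  calc ∫⁻ x, ‖f (e x)‖ₑ ^ 2 ≤
      ∫⁻ x, ∏ i, (∫⁻ t, F (e (Function.update x i t))) := by
        refine lintegral_mono fun x => ?_
        rw [Fin.prod_univ_two, sq]
        exact mul_le_mul' (key x 0) (key x 1)
    _ ≤ _ := by
        have h1 : (1 : ℝ) / (((Fintype.card (Fin 2) : ℕ) : ℝ) - 1) = 1 := by norm_num
        simp only [h1, ENNReal.rpow_one] at hgrid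
        exact_mod_cast hgrid

theorem LipschitzWith.integral_lineDeriv_eq_zero {f : Plane → ℝ} {C : NNReal}
    (hf : LipschitzWith C f) (hc : HasCompactSupport f) (v : Plane) :
    ∫ x, lineDeriv ℝ f x v = 0 := by
  have h := (LipschitzWith.const (1 : ℝ)).integral_lineDeriv_mul_eq (μ := volume) hf hc (-v)
  have h0 : ∀ x : Plane, lineDeriv ℝ (fun _ : Plane => (1 : ℝ)) x (-v) = 0 := fun x => by
    simp [lineDeriv]
  simpa [h0] using h.symm

/-! ### Square integrable functions -/

theorem MeasureTheory.MemLp.toReal_eLpNorm_two {X E : Type*} [MeasurableSpace X] {μ : Measure X}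
    [NormedAddCommGroup E] {f : X → E} (hf : MemLp f 2 μ) :
    (eLpNorm f 2 μ).toReal = √(∫ x, ‖f x‖ ^ 2 ∂μ) := by
  rw [hf.eLpNorm_eq_integral_rpow_norm (by norm_num) (by norm_num), ENNReal.toReal_ofReal
    (by positivity), Real.sqrt_eq_rpow]
  norm_num

section L2

variable {X E : Type*} [MeasurableSpace X] {μ : Measure X} [NormedAddCommGroup E]
  [InnerProductSpace ℝ E]

/-- The Cauchy–Schwarz inequality in `L²`. -/
theorem abs_integral_inner_le {f g : X → E} (hf : MemLp f 2 μ) (hg : MemLp g 2 μ) :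
    |∫ x, inner ℝ (f x) (g x) ∂μ| ≤ √(∫ x, ‖f x‖ ^ 2 ∂μ) * √(∫ x, ‖g x‖ ^ 2 ∂μ) := by
  have h := abs_real_inner_le_norm (hf.toLp f) (hg.toLp g)
  rw [L2.inner_def, Lp.norm_toLp, Lp.norm_toLp, hf.toReal_eLpNorm_two, hg.toReal_eLpNorm_two] at h
  convert h using 2
  refine integral_congr_ae ?_
  filter_upwards [hf.coeFn_toLp, hg.coeFn_toLp] with x h1 h2
  rw [h1, h2]

theorem abs_integral_mul_le {f g : X → ℝ} (hf : MemLp f 2 μ) (hg : MemLp g 2 μ) :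
    |∫ x, f x * g x ∂μ| ≤ √(∫ x, f x ^ 2 ∂μ) * √(∫ x, g x ^ 2 ∂μ) := by
  simpa [mul_comm] using abs_integral_inner_le hf hg

theorem integrable_inner_of_memLp {f g : X → E} (hf : MemLp f 2 μ) (hg : MemLp g 2 μ) :
    Integrable (fun x => inner ℝ (f x) (g x)) μ := by
  refine (L2.integrable_inner (𝕜 := ℝ) (hf.toLp f) (hg.toLp g)).congr ?_
  filter_upwards [hf.coeFn_toLp, hg.coeFn_toLp] with x h1 h2
  rw [h1, h2]

variable {V W : Type*} [AddCommGroup V] [Module ℝ V] [AddCommGroup W] [Module ℝ W]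

/-- A family of square integrable functions which depends linearly on its parameter, up to null
sets. -/
structure IsL2Linear (μ : Measure X) (F : V → X → E) : Prop where
  memLp : ∀ v, MemLp (F v) 2 μ
  map_add : ∀ v w, F (v + w) =ᵐ[μ] fun x => F v x + F w x
  map_smul : ∀ (c : ℝ) v, F (c • v) =ᵐ[μ] fun x => c • F v x

namespace IsL2Linear

variable {F G : V → X → E} {H : W → X → E}

/-- The induced linear map to `L²`. -/
noncomputable def toLp (hF : IsL2Linear μ F) : V →ₗ[ℝ] Lp E 2 μ where
  toFun v := (hF.memLp v).toLp (F v)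
  map_add' v w := by
    rw [← MemLp.toLp_add]
    exact (MemLp.toLp_eq_toLp_iff _ _).2 (hF.map_add v w)
  map_smul' c v := by
    rw [RingHom.id_apply, ← MemLp.toLp_const_smul]
    exact (MemLp.toLp_eq_toLp_iff _ _).2 (hF.map_smul c v)

/-- The integral of the inner product is a bilinear form. -/
theorem exists_bilin (hF : IsL2Linear μ F) (hH : IsL2Linear μ H) :
    ∃ B : V →ₗ[ℝ] W →ₗ[ℝ] ℝ, ∀ v w, B v w = ∫ x, inner ℝ (F v x) (H w x) ∂μ := by
  refine ⟨((innerₗ (Lp E 2 μ)).comp hF.toLp).compl₂ hH.toLp, fun v w => ?_⟩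
  simp only [LinearMap.compl₂_apply, LinearMap.comp_apply, innerₗ_apply_apply]
  rw [L2.inner_def]
  refine integral_congr_ae ?_
  filter_upwards [(hF.memLp v).coeFn_toLp, (hH.memLp w).coeFn_toLp] with x h1 h2
  simp only [toLp, LinearMap.coe_mk, AddHom.coe_mk]
  rw [h1, h2]

/-- The integral of the inner product with a fixed function is a linear form. -/
theorem exists_linear (hH : IsL2Linear μ H) {f : X → E} (hf : MemLp f 2 μ) :
    ∃ B : W →ₗ[ℝ] ℝ, ∀ w, B w = ∫ x, inner ℝ (f x) (H w x) ∂μ := by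
  have hF : IsL2Linear μ fun (c : ℝ) x => c • f x :=
    ⟨fun c => hf.const_smul c, fun _ _ => .of_forall fun x => add_smul _ _ _,
      fun _ _ => .of_forall fun x => mul_smul _ _ _⟩
  obtain ⟨B, hB⟩ := hF.exists_bilin hH
  exact ⟨B 1, fun w => by simp [hB]⟩

theorem add (hF : IsL2Linear μ F) (hG : IsL2Linear μ G) :
    IsL2Linear μ fun v x => F v x + G v x where
  memLp v := (hF.memLp v).add (hG.memLp v)
  map_add v w := by
    filter_upwards [hF.map_add v w, hG.map_add v w] with x h1 h2
    rw [h1, h2, add_add_add_comm]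
  map_smul c v := by
    filter_upwards [hF.map_smul c v, hG.map_smul c v] with x h1 h2
    rw [h1, h2, smul_add]

theorem const_smul (hF : IsL2Linear μ F) (a : ℝ) : IsL2Linear μ fun v x => a • F v x where
  memLp v := (hF.memLp v).const_smul a
  map_add v w := by
    filter_upwards [hF.map_add v w] with x h1
    rw [h1, smul_add]
  map_smul c v := by
    filter_upwards [hF.map_smul c v] with x h1
    rw [h1, smul_comm]

theorem mono_measure {ν : Measure X} (hF : IsL2Linear μ F) (h : ν ≤ μ) : IsL2Linear ν F where
  memLp v := (hF.memLp v).mono_measure h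
  map_add v w := Measure.absolutelyContinuous_of_le h (hF.map_add v w)
  map_smul c v := Measure.absolutelyContinuous_of_le h (hF.map_smul c v)

theorem comp (hF : IsL2Linear μ F) (L : W →ₗ[ℝ] V) : IsL2Linear μ fun w => F (L w) where
  memLp v := hF.memLp _
  map_add v w := by rw [L.map_add]; exact hF.map_add _ _
  map_smul c v := by rw [L.map_smul]; exact hF.map_smul _ _

end IsL2Linear

end L2

/-! ### Quadratic functions in the plane -/

/-- The quadratic function with the given coefficients. -/
def quad (c : Fin 6 → ℝ) (x : Plane) : ℝ :=
  c 0 + c 1 * x 0 + c 2 * x 1 + c 3 * x 0 ^ 2 + c 4 * (x 0 * x 1) + c 5 * x 1 ^ 2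

/-- The gradient of a quadratic function. -/
noncomputable def quadGrad (c : Fin 6 → ℝ) (x : Plane) : Plane :=
  !₂[c 1 + 2 * c 3 * x 0 + c 4 * x 1, c 2 + c 4 * x 0 + 2 * c 5 * x 1]

@[fun_prop]
theorem contDiff_quad (c : Fin 6 → ℝ) : ContDiff ℝ ∞ (quad c) := by
  unfold quad
  fun_prop

@[fun_prop]
theorem continuous_quad (c : Fin 6 → ℝ) : Continuous (quad c) := (contDiff_quad c).continuous

theorem quad_add (c d : Fin 6 → ℝ) (x : Plane) : quad (c + d) x = quad c x + quad d x := by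
  simp only [quad, Pi.add_apply]
  ring

theorem quad_smul (a : ℝ) (c : Fin 6 → ℝ) (x : Plane) : quad (a • c) x = a * quad c x := by
  simp only [quad, Pi.smul_apply, smul_eq_mul]
  ring

theorem quadGrad_add (c d : Fin 6 → ℝ) (x : Plane) :
    quadGrad (c + d) x = quadGrad c x + quadGrad d x := by
  ext i
  fin_cases i <;> simp [quadGrad] <;> ring

theorem quadGrad_smul (a : ℝ) (c : Fin 6 → ℝ) (x : Plane) :
    quadGrad (a • c) x = a • quadGrad c x := by
  ext i
  fin_cases i <;> simp [quadGrad] <;> ring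

theorem hasFDerivAt_coord (i : Fin 2) (x : Plane) :
    HasFDerivAt (fun y : Plane => y i) (EuclideanSpace.proj i : Plane →L[ℝ] ℝ) x :=
  (EuclideanSpace.proj i : Plane →L[ℝ] ℝ).hasFDerivAt

theorem hasGradientAt_quad (c : Fin 6 → ℝ) (x : Plane) :
    HasGradientAt (quad c) (quadGrad c x) x := by
  rw [hasGradientAt_iff_hasFDerivAt]
  have h0 := hasFDerivAt_coord 0 x
  have h1 := hasFDerivAt_coord 1 x
  have := (((((hasFDerivAt_const (c 0) x).add (h0.const_mul (c 1))).add (h1.const_mul (c 2))).add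
    ((h0.pow 2).const_mul (c 3))).add ((h0.mul h1).const_mul (c 4))).add ((h1.pow 2).const_mul (c 5))
  refine (this.congr_fderiv ?_).congr_of_eventuallyEq (.of_forall fun y => ?_)
  · ext v
    simp [quadGrad, PiLp.inner_apply]
    ring
  · simp [quad]

theorem hasFDerivAt_quadGrad_apply (c : Fin 6 → ℝ) (i : Fin 2) (x : Plane) :
    ∃ L : Plane →L[ℝ] ℝ, HasFDerivAt (fun y => quadGrad c y i) L x ∧
      L (EuclideanSpace.single i 1) = 2 * (if i = 0 then c 3 else c 5) := by
  have h0 := hasFDerivAt_coord 0 x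
  have h1 := hasFDerivAt_coord 1 x
  fin_cases i
  · refine ⟨_, ((hasFDerivAt_const (c 1) x).add (h0.const_mul (2 * c 3))).add
      (h1.const_mul (c 4)), ?_⟩
    simp
  · refine ⟨_, ((hasFDerivAt_const (c 2) x).add (h0.const_mul (c 4))).add
      (h1.const_mul (2 * c 5)), ?_⟩
    simp

theorem exists_quad_of_totalDegree_le {p : MvPolynomial (Fin 2) ℝ} (hp : p.totalDegree ≤ 2) :
    ∃ c : Fin 6 → ℝ, ∀ x : Plane, MvPolynomial.eval (fun i => x i) p = quad c x := by
  classical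
  set f : ℕ × ℕ → (Fin 2 →₀ ℕ) := fun d => Finsupp.equivFunOnFinite.symm ![d.1, d.2] with hf
  have hinj : Function.Injective f := by
    intro a b hab
    have h0 := DFunLike.congr_fun hab 0
    have h1 := DFunLike.congr_fun hab 1
    exact Prod.ext (by simpa [hf] using h0) (by simpa [hf] using h1)
  set S : Finset (ℕ × ℕ) := {(0, 0), (1, 0), (0, 1), (2, 0), (1, 1), (0, 2)} with hS
  have hsub : p.support ⊆ S.image f := by
    intro d hd
    have hdeg := (MvPolynomial.le_totalDegree hd).trans hp
    rw [Finsupp.sum_fintype _ _ (fun _ => rfl), Fin.sum_univ_two] at hdeg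
    refine Finset.mem_image.2 ⟨(d 0, d 1), ?_, ?_⟩
    · have h0 : d 0 ≤ 2 := by omega
      have h1 : d 1 ≤ 2 := by omega
      simp only [hS, Finset.mem_insert, Finset.mem_singleton, Prod.mk.injEq]
      omega
    · ext i
      fin_cases i <;> simp [hf]
  refine ⟨![p.coeff (f (0, 0)), p.coeff (f (1, 0)), p.coeff (f (0, 1)), p.coeff (f (2, 0)),
    p.coeff (f (1, 1)), p.coeff (f (0, 2))], fun x => ?_⟩
  rw [MvPolynomial.eval_eq', Finset.sum_subset hsub (fun d _ hd => by
    rw [MvPolynomial.notMem_support_iff.1 hd, zero_mul]), Finset.sum_image hinj.injOn]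
  simp [hS, hf, quad]
  ring

theorem measurable_gradient (f : Plane → ℝ) : Measurable (gradient f) :=
  (InnerProductSpace.toDual ℝ Plane).symm.continuous.measurable.comp (measurable_fderiv ℝ f)

/-! ### Geometry of a triangulation -/

namespace Triangulation

variable {Ω : Set Plane} (T : Triangulation Ω)

theorem isOpen_elem (e : Fin T.nel) : IsOpen (T.elem e) := isOpen_interior

theorem measurableSet_elem (e : Fin T.nel) : MeasurableSet (T.elem e) :=
  (T.isOpen_elem e).measurableSet

theorem nonempty_elem (e : Fin T.nel) : (T.elem e).Nonempty := by
  rw [elem, interior_convexHull_nonempty_iff_affineSpan_eq_top,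
    (T.nondegenerate e).affineSpan_eq_top_iff_card_eq_finrank_add_one]
  simp

theorem isCompact_convexHull (e : Fin T.nel) : IsCompact (convexHull ℝ (range (T.vert e))) :=
  (finite_range (T.vert e)).isCompact_convexHull (𝕜 := ℝ)

theorem closure_elem (e : Fin T.nel) : closure (T.elem e) = convexHull ℝ (range (T.vert e)) := by
  have h : Convex ℝ (convexHull ℝ (range (T.vert e))) := convex_convexHull ℝ _
  exact (Convex.closure_interior_eq_closure_of_nonempty_interior (𝕜 := ℝ) h (T.nonempty_elem e)).trans
    (T.isCompact_convexHull e).isClosed.closure_eq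

theorem isCompact_closure_elem (e : Fin T.nel) : IsCompact (closure (T.elem e)) :=
  T.closure_elem e ▸ T.isCompact_convexHull e

theorem isBounded_elem (e : Fin T.nel) : Bornology.IsBounded (T.elem e) :=
  (T.isCompact_closure_elem e).isBounded.subset subset_closure

theorem closure_eq_iUnion :
    closure Ω = ⋃ e, closure (T.elem e) := by
  simp_rw [T.closure_elem, T.cover]

theorem closure_elem_subset (e : Fin T.nel) : closure (T.elem e) ⊆ closure Ω :=
  T.closure_eq_iUnion ▸ subset_iUnion (fun e => closure (T.elem e)) e

theorem isCompact_closure {Ω : Set Plane} (T : Triangulation Ω) : IsCompact (closure Ω) :=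
  T.closure_eq_iUnion ▸ isCompact_iUnion T.isCompact_closure_elem

theorem elem_subset (e : Fin T.nel) : T.elem e ⊆ Ω := T.interior_subset e

theorem size_pos (e : Fin T.nel) : 0 < T.size e := by
  refine lt_of_le_of_ne Metric.diam_nonneg fun h => ?_
  obtain ⟨x, hx⟩ := T.nonempty_elem e
  obtain ⟨y, hy, hne⟩ := ((T.isOpen_elem e).mem_nhds hx |> fun h =>
    (preperfect_iff_nhds.1 isOpen_univ.preperfect x (mem_univ x) _ h))
  have h1 := Metric.dist_le_diam_of_mem (T.isBounded_elem e) hy.1 hx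
  rw [← size, ← h] at h1
  exact hne (dist_le_zero.1 h1)

theorem volume_elem_lt_top (e : Fin T.nel) : volume (T.elem e) < ⊤ :=
  (T.isBounded_elem e).measure_lt_top

theorem volume_elem_pos (e : Fin T.nel) : 0 < volume (T.elem e) :=
  (T.isOpen_elem e).measure_pos volume (T.nonempty_elem e)

theorem isFiniteMeasure_elem (e : Fin T.nel) : IsFiniteMeasure (volume.restrict (T.elem e)) :=
  isFiniteMeasure_restrict.2 (T.volume_elem_lt_top e).ne

theorem isFiniteMeasure {Ω : Set Plane} (T : Triangulation Ω) :
    IsFiniteMeasure (volume.restrict Ω) :=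
  isFiniteMeasure_restrict.2
    ((measure_mono subset_closure).trans_lt T.isCompact_closure.measure_lt_top).ne

theorem restrict_eq_sum (hΩ : IsOpen Ω) :
    volume.restrict Ω = ∑ e, volume.restrict (T.elem e) := by
  have h1 : (⋃ e, T.elem e) =ᵐ[volume] Ω := by
    have h := (ae_restrict_iff' hΩ.measurableSet).1
      (T.ae_of_forall_elem (p := fun x => x ∈ ⋃ e, T.elem e)
        fun e x hx => mem_iUnion.2 ⟨e, hx⟩)
    filter_upwards [h] with x hx
    exact propext ⟨fun h' => iUnion_subset T.elem_subset h', hx⟩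
  have h2 : Pairwise (Function.onFun Disjoint T.elem) := fun e e' h => T.disjoint_interior e e' h
  rw [← Measure.restrict_congr_set h1, Measure.restrict_iUnion h2 T.measurableSet_elem,
    Measure.sum_fintype]

theorem integral_eq_sum (hΩ : IsOpen Ω) {f : Plane → ℝ}
    (hf : ∀ e, IntegrableOn f (T.elem e)) : ∫ x in Ω, f x = ∑ e, ∫ x in T.elem e, f x := by
  rw [T.restrict_eq_sum hΩ, integral_finsetSum_measure fun e _ => hf e]

theorem restrict_elem_le (e : Fin T.nel) : volume.restrict (T.elem e) ≤ volume.restrict Ω :=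
  Measure.restrict_mono_set _ (T.elem_subset e)

/-- A function is square integrable on `Ω` if it is square integrable on every element. -/
theorem memLp_of_forall_elem (hΩ : IsOpen Ω) {E : Type*} [NormedAddCommGroup E] {f : Plane → E}
    {M : ℝ} (hf : ∀ e, AEStronglyMeasurable f (volume.restrict (T.elem e)))
    (hM : ∀ e, ∀ x ∈ T.elem e, ‖f x‖ ≤ M) : MemLp f 2 (volume.restrict Ω) := by
  have := T.isFiniteMeasure
  refine MemLp.of_bound ?_ M (T.ae_of_forall_elem hM)
  rw [T.restrict_eq_sum hΩ, ← Measure.sum_fintype, aestronglyMeasurable_sum_measure_iff]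
  exact hf

/-! ### Continuous piecewise quadratic functions -/

theorem exists_quad {φ : Plane → ℝ} (hφ : φ ∈ T.P2Space) (e : Fin T.nel) :
    ∃ c, EqOn φ (quad c) (closure (T.elem e)) := by
  obtain ⟨p, hp, hp'⟩ := hφ.2.2 e
  obtain ⟨c, hc⟩ := exists_quad_of_totalDegree_le hp
  refine ⟨c, EqOn.of_subset_closure (s := T.elem e) (fun x hx => ?_)
    (hφ.1.mono (T.closure_elem_subset e)) (continuous_quad c).continuousOn subset_closure le_rfl⟩
  rw [hp' x hx, hc]

variable {T}

theorem hasGradientAt_of_eqOn {φ : Plane → ℝ} {c : Fin 6 → ℝ} {e : Fin T.nel}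
    (h : EqOn φ (quad c) (T.elem e)) {x : Plane} (hx : x ∈ T.elem e) :
    HasGradientAt φ (quadGrad c x) x := by
  have := hasGradientAt_quad c x
  rw [hasGradientAt_iff_hasFDerivAt] at this ⊢
  exact this.congr_of_eventuallyEq (h.eventuallyEq_of_mem ((T.isOpen_elem e).mem_nhds hx))

theorem gradient_eq_of_eqOn {φ : Plane → ℝ} {c : Fin 6 → ℝ} {e : Fin T.nel}
    (h : EqOn φ (quad c) (T.elem e)) {x : Plane} (hx : x ∈ T.elem e) :
    gradient φ x = quadGrad c x :=
  (hasGradientAt_of_eqOn h hx).gradient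

theorem divDGrad_eq_of_eqOn {φ D : Plane → ℝ} {c : Fin 6 → ℝ} {e : Fin T.nel}
    (h : EqOn φ (quad c) (T.elem e)) {x : Plane} (hx : x ∈ T.elem e)
    (hD : DifferentiableAt ℝ D x) :
    divDGrad D φ x = fderiv ℝ D x (quadGrad c x) + D x * (2 * (c 3 + c 5)) := by
  have hev : ∀ i : Fin 2, (fun y => D y * gradient φ y i) =ᶠ[nhds x]
      fun y => D y * quadGrad c y i := fun i =>
    Filter.eventually_of_mem ((T.isOpen_elem e).mem_nhds hx) fun y hy => by
      simp only [gradient_eq_of_eqOn h hy]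
  have hsum : quadGrad c x = ∑ i : Fin 2, quadGrad c x i • EuclideanSpace.single i (1 : ℝ) := by
    ext j
    fin_cases j <;> simp [Fin.sum_univ_two]
  have hterm : ∀ i : Fin 2, fderiv ℝ (fun y => D y * gradient φ y i) x
      (EuclideanSpace.single i 1) = quadGrad c x i * fderiv ℝ D x (EuclideanSpace.single i 1)
        + D x * (2 * (if i = 0 then c 3 else c 5)) := by
    intro i
    obtain ⟨L, hL, hL'⟩ := hasFDerivAt_quadGrad_apply c i x
    rw [(hev i).fderiv_eq, (hD.hasFDerivAt.fun_mul hL).fderiv]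
    simp [hL', add_comm]
  rw [divDGrad]
  simp_rw [hterm]
  conv_rhs => rw [hsum]
  simp only [map_add, map_smul, Fin.sum_univ_two, smul_eq_mul]
  simp
  ring

variable (T)

theorem finiteDimensional_P2Space : FiniteDimensional ℝ T.P2Space := by
  let R : T.P2Space →ₗ[ℝ] ((e : Fin T.nel) → T.elem e → ℝ) :=
    { toFun := fun φ e x => (φ : Plane → ℝ) x
      map_add' := fun _ _ => rfl
      map_smul' := fun _ _ => rfl }
  let Q : (Fin T.nel → Fin 6 → ℝ) →ₗ[ℝ] ((e : Fin T.nel) → T.elem e → ℝ) :=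
    { toFun := fun c e x => quad (c e) x
      map_add' := fun c d => by
        funext e x
        exact quad_add _ _ _
      map_smul' := fun a c => by
        funext e x
        exact quad_smul _ _ _ }
  have hRQ : ∀ φ, R φ ∈ Q.range := by
    intro φ
    choose c hc using T.exists_quad φ.2
    refine ⟨c, ?_⟩
    funext e x
    exact (hc e (subset_closure x.2)).symm
  have hinj : Function.Injective R := by
    rw [injective_iff_map_eq_zero]
    rintro ⟨φ, hφ⟩ h
    ext x
    by_cases hx : x ∈ closure Ω
    · have hx' := hx
      rw [T.closure_eq_iUnion] at hx'
      obtain ⟨e, he⟩ := mem_iUnion.1 hx'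
      have : EqOn φ (fun _ => 0) (closure (T.elem e)) :=
        EqOn.of_subset_closure (s := T.elem e) (fun y hy => congr_fun (congr_fun h e) ⟨y, hy⟩)
          (hφ.1.mono (T.closure_elem_subset e)) continuousOn_const subset_closure le_rfl
      exact this he
    · exact hφ.2.1 x hx
  exact FiniteDimensional.of_injective (R.codRestrict Q.range hRQ)
    (fun _ _ h => hinj (Subtype.ext_iff.1 h))

/-- `w` is continuously differentiable on every closed element. -/
def PiecewiseC1 (w : Plane → ℝ) : Prop :=
  ∀ e, ∃ q : Plane → ℝ, ContDiff ℝ 1 q ∧ EqOn w q (closure (T.elem e))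

variable {T}

theorem piecewiseC1_of_mem_P2Space {φ : Plane → ℝ} (hφ : φ ∈ T.P2Space) : T.PiecewiseC1 φ :=
  fun e => by
    obtain ⟨c, hc⟩ := T.exists_quad hφ e
    exact ⟨quad c, (contDiff_quad c).of_le (by exact_mod_cast le_top), hc⟩

namespace PiecewiseC1

variable {v w : Plane → ℝ}

theorem mul (hv : T.PiecewiseC1 v) (hw : T.PiecewiseC1 w) : T.PiecewiseC1 fun x => v x * w x :=
  fun e => by
    obtain ⟨p, hp, hvp⟩ := hv e
    obtain ⟨q, hq, hwq⟩ := hw e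
    exact ⟨fun x => p x * q x, hp.mul hq, fun x hx => by simp only [hvp hx, hwq hx]⟩

theorem differentiableAt (hw : T.PiecewiseC1 w) {e : Fin T.nel} {x : Plane}
    (hx : x ∈ T.elem e) : DifferentiableAt ℝ w x := by
  obtain ⟨q, hq, hwq⟩ := hw e
  exact (hq.differentiable one_ne_zero x).congr_of_eventuallyEq
    (Filter.eventually_of_mem ((T.isOpen_elem e).mem_nhds hx) fun y hy => hwq (subset_closure hy))

theorem exists_bound (hw : T.PiecewiseC1 w) : ∃ M, 0 ≤ M ∧ ∀ x ∈ closure Ω, |w x| ≤ M := by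
  have h : ∀ e, ∃ M, ∀ x ∈ closure (T.elem e), |w x| ≤ M := fun e => by
    obtain ⟨q, hq, hwq⟩ := hw e
    exact (T.isCompact_closure_elem e).exists_bound_of_continuousOn
      (hq.continuous.continuousOn.congr hwq)
  choose M hM using h
  obtain ⟨M', hM'⟩ := (finite_range M).bddAbove
  refine ⟨max M' 0, le_max_right _ _, fun x hx => ?_⟩
  rw [T.closure_eq_iUnion] at hx
  obtain ⟨e, he⟩ := mem_iUnion.1 hx
  exact (hM e x he).trans ((hM' ⟨e, rfl⟩).trans (le_max_left _ _))

theorem exists_bound_gradient (hw : T.PiecewiseC1 w) :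
    ∃ M, ∀ e, ∀ x ∈ T.elem e, ‖gradient w x‖ ≤ M := by
  have h : ∀ e, ∃ M, ∀ x ∈ T.elem e, ‖gradient w x‖ ≤ M := fun e => by
    obtain ⟨q, hq, hwq⟩ := hw e
    have hc : Continuous (gradient q) := (InnerProductSpace.toDual ℝ Plane).symm.continuous.comp
      (hq.continuous_fderiv one_ne_zero)
    obtain ⟨M, hM⟩ := (T.isCompact_closure_elem e).exists_bound_of_continuousOn hc.continuousOn
    refine ⟨M, fun x hx => ?_⟩
    have heq : w =ᶠ[nhds x] q := Filter.eventually_of_mem ((T.isOpen_elem e).mem_nhds hx)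
      fun y hy => hwq (subset_closure hy)
    rw [heq.gradient_eq]
    exact hM x (subset_closure hx)
  choose M hM using h
  obtain ⟨M', hM'⟩ := (finite_range M).bddAbove
  exact ⟨M', fun e x hx => (hM e x hx).trans (hM' ⟨e, rfl⟩)⟩

theorem memLp (hw : T.PiecewiseC1 w) (hΩ : IsOpen Ω) : MemLp w 2 (volume.restrict Ω) := by
  obtain ⟨M, -, hM⟩ := hw.exists_bound
  refine T.memLp_of_forall_elem hΩ (fun e => ContinuousOn.aestronglyMeasurable
    (fun x hx => (hw.differentiableAt hx).continuousAt.continuousWithinAt) (T.measurableSet_elem e))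
    fun e x hx => hM x (T.closure_elem_subset e (subset_closure hx))

theorem memLp_gradient (hw : T.PiecewiseC1 w) (hΩ : IsOpen Ω) :
    MemLp (gradient w) 2 (volume.restrict Ω) := by
  obtain ⟨M, hM⟩ := hw.exists_bound_gradient
  exact T.memLp_of_forall_elem hΩ (fun e => (measurable_gradient w).aestronglyMeasurable) hM

end PiecewiseC1

variable (T)

theorem isL2Linear_coe (hΩ : IsOpen Ω) :
    IsL2Linear (volume.restrict Ω) fun φ : T.P2Space => (φ : Plane → ℝ) where
  memLp φ := (piecewiseC1_of_mem_P2Space φ.2).memLp hΩ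
  map_add _ _ := .rfl
  map_smul _ _ := .rfl

theorem gradient_add_of_mem {φ ψ : Plane → ℝ} (hφ : φ ∈ T.P2Space) (hψ : ψ ∈ T.P2Space)
    {e : Fin T.nel} {x : Plane} (hx : x ∈ T.elem e) :
    gradient (φ + ψ) x = gradient φ x + gradient ψ x := by
  rw [gradient, fderiv_add (T.differentiableAt_of_mem hφ e x hx)
    (T.differentiableAt_of_mem hψ e x hx), map_add]
  rfl

theorem gradient_smul_of_mem (a : ℝ) {φ : Plane → ℝ} (hφ : φ ∈ T.P2Space)
    {e : Fin T.nel} {x : Plane} (hx : x ∈ T.elem e) :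
    gradient (a • φ) x = a • gradient φ x := by
  rw [gradient, fderiv_const_smul (T.differentiableAt_of_mem hφ e x hx)]
  simp [gradient]

theorem isL2Linear_gradient (hΩ : IsOpen Ω) :
    IsL2Linear (volume.restrict Ω) fun φ : T.P2Space => gradient (φ : Plane → ℝ) where
  memLp φ := (piecewiseC1_of_mem_P2Space φ.2).memLp_gradient hΩ
  map_add φ ψ := T.ae_of_forall_elem fun _ _ hx => T.gradient_add_of_mem φ.2 ψ.2 hx
  map_smul a φ := T.ae_of_forall_elem fun _ _ hx => T.gradient_smul_of_mem a φ.2 hx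

theorem isL2Linear_convection {u : Plane → Plane} :
    IsL2Linear (volume.restrict Ω)
      fun (φ : T.supgSpace u) x => inner ℝ (u x) (gradient (φ : Plane → ℝ) x) where
  memLp φ := φ.2.2
  map_add φ ψ := T.ae_of_forall_elem fun e x hx => by
    have := T.gradient_add_of_mem φ.2.1 ψ.2.1 hx
    simp only [Submodule.coe_add, this, inner_add_right]
  map_smul a φ := T.ae_of_forall_elem fun e x hx => by
    have := T.gradient_smul_of_mem a φ.2.1 hx
    simp only [Submodule.coe_smul, this, inner_smul_right, smul_eq_mul]

end Triangulation

/-! ### Elementwise Lipschitz coefficients -/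

namespace Triangulation

variable {Ω : Set Plane} {T : Triangulation Ω} {D : Plane → ℝ}

namespace ElementwiseLipschitz

theorem exists_bound (hD : T.ElementwiseLipschitz D) :
    ∃ M, 0 ≤ M ∧ ∀ e, ∀ x ∈ T.elem e, |D x| ≤ M := by
  have h : ∀ e, ∃ M, ∀ x ∈ T.elem e, |D x| ≤ M := by
    intro e
    obtain ⟨L, hL⟩ := hD e
    obtain ⟨g, hg, hgD⟩ := hL.extend_real
    obtain ⟨M, hM⟩ := (T.isCompact_closure_elem e).exists_bound_of_continuousOn
      hg.continuous.continuousOn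
    exact ⟨M, fun x hx => hgD hx ▸ hM x (subset_closure hx)⟩
  choose M hM using h
  obtain ⟨M', hM'⟩ := (finite_range M).bddAbove
  exact ⟨max M' 0, le_max_right _ _, fun e x hx =>
    (hM e x hx).trans ((hM' ⟨e, rfl⟩).trans (le_max_left _ _))⟩

theorem aestronglyMeasurable_elem (hD : T.ElementwiseLipschitz D) (e : Fin T.nel) :
    AEStronglyMeasurable D (volume.restrict (T.elem e)) := by
  obtain ⟨L, hL⟩ := hD e
  exact hL.continuousOn.aestronglyMeasurable (T.measurableSet_elem e)

theorem aestronglyMeasurable (hD : T.ElementwiseLipschitz D) (hΩ : IsOpen Ω) :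
    AEStronglyMeasurable D (volume.restrict Ω) := by
  rw [T.restrict_eq_sum hΩ, ← Measure.sum_fintype, aestronglyMeasurable_sum_measure_iff]
  exact hD.aestronglyMeasurable_elem

theorem eLpNorm_top_lt_top (hD : T.ElementwiseLipschitz D) (hΩ : IsOpen Ω) :
    eLpNorm D ⊤ (volume.restrict Ω) < ⊤ := by
  obtain ⟨M, -, hM⟩ := hD.exists_bound
  exact (memLp_top_of_bound (hD.aestronglyMeasurable hΩ) M
    (T.ae_of_forall_elem hM)).eLpNorm_lt_top

theorem ae_abs_le_supNorm (hD : T.ElementwiseLipschitz D) (hΩ : IsOpen Ω) :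
    ∀ᵐ x ∂(volume.restrict Ω), |D x| ≤ supNorm Ω D := by
  have hfin := (hD.eLpNorm_top_lt_top hΩ).ne
  rw [eLpNorm_exponent_top] at hfin
  filter_upwards [ae_le_eLpNormEssSup (f := D) (μ := volume.restrict Ω)] with x hx
  have := ENNReal.toReal_mono hfin hx
  rwa [toReal_enorm, Real.norm_eq_abs] at this

theorem supNorm_elem_pos (hD : T.ElementwiseLipschitz D) (hΩ : IsOpen Ω)
    (h1 : ∀ᵐ x ∂(volume.restrict Ω), 1 ≤ D x) (e : Fin T.nel) : 0 < supNorm (T.elem e) D := by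
  have hfin : eLpNorm D ⊤ (volume.restrict (T.elem e)) ≠ ⊤ :=
    ((eLpNorm_mono_measure D (T.restrict_elem_le e)).trans_lt (hD.eLpNorm_top_lt_top hΩ)).ne
  refine ENNReal.toReal_pos (fun h0 => ?_) hfin
  rw [eLpNorm_eq_zero_iff (hD.aestronglyMeasurable_elem e) (by simp)] at h0
  have h2 : ∀ᵐ x ∂(volume.restrict (T.elem e)), 1 ≤ D x :=
    Measure.absolutelyContinuous_of_le (T.restrict_elem_le e) h1
  have h3 : ∀ᵐ x ∂(volume.restrict (T.elem e)), False := by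
    filter_upwards [h0, h2] with x hx hx'
    rw [hx] at hx'
    exact absurd hx' (by norm_num)
  rw [Filter.eventually_false_iff_eq_bot, ae_eq_bot, Measure.restrict_eq_zero] at h3
  exact (T.volume_elem_pos e).ne' h3

theorem ae_differentiableAt (hD : T.ElementwiseLipschitz D) (e : Fin T.nel) :
    ∃ L : ℝ, 0 ≤ L ∧ ∀ᵐ x ∂(volume.restrict (T.elem e)), x ∈ T.elem e ∧
      DifferentiableAt ℝ D x ∧ ‖fderiv ℝ D x‖ ≤ L := by
  obtain ⟨L, hL⟩ := hD e
  refine ⟨L, L.2, ?_⟩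
  rw [ae_restrict_iff' (T.measurableSet_elem e)]
  filter_upwards [hL.ae_differentiableWithinAt_of_mem (μ := volume)] with x hx hxe
  have hnhds := (T.isOpen_elem e).mem_nhds hxe
  exact ⟨hxe, (hx hxe).differentiableAt hnhds, norm_fderiv_le_of_lipschitzOn ℝ hnhds hL⟩

end ElementwiseLipschitz

theorem _root_.measurable_divDGrad (D φ : Plane → ℝ) : Measurable (divDGrad D φ) :=
  Finset.measurable_sum _ fun _ _ => measurable_fderiv_apply_const ℝ _ _

theorem isL2Linear_smul {V E : Type*} [AddCommGroup V] [Module ℝ V] [NormedAddCommGroup E]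
    [InnerProductSpace ℝ E] {F : V → Plane → E} (hΩ : IsOpen Ω) (hD : T.ElementwiseLipschitz D)
    (hF : IsL2Linear (volume.restrict Ω) F) :
    IsL2Linear (volume.restrict Ω) fun v x => D x • F v x where
  memLp v := by
    refine MemLp.of_le_mul (c := supNorm Ω D) (hF.memLp v)
      ((hD.aestronglyMeasurable hΩ).smul (hF.memLp v).1) ?_
    filter_upwards [hD.ae_abs_le_supNorm hΩ] with x hx
    rw [norm_smul]
    exact mul_le_mul_of_nonneg_right hx (norm_nonneg _)
  map_add v w := by
    filter_upwards [hF.map_add v w] with x hx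
    rw [hx, smul_add]
  map_smul a v := by
    filter_upwards [hF.map_smul a v] with x hx
    rw [hx, smul_comm]

theorem isL2Linear_divDGrad (hD : T.ElementwiseLipschitz D) (e : Fin T.nel) :
    IsL2Linear (volume.restrict (T.elem e)) fun φ : T.P2Space => divDGrad D (φ : Plane → ℝ) where
  memLp φ := by
    have := T.isFiniteMeasure_elem e
    obtain ⟨c, hc⟩ := T.exists_quad φ.2 e
    obtain ⟨L, hL0, hL⟩ := hD.ae_differentiableAt e
    obtain ⟨M, hM0, hM⟩ := hD.exists_bound
    obtain ⟨K, hK⟩ := (piecewiseC1_of_mem_P2Space φ.2).exists_bound_gradient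
    refine MemLp.of_bound (measurable_divDGrad _ _).aestronglyMeasurable
      (L * K + M * |2 * (c 3 + c 5)|) ?_
    filter_upwards [hL] with x hx
    have hc' := hc.mono subset_closure
    rw [divDGrad_eq_of_eqOn hc' hx.1 hx.2.1, ← gradient_eq_of_eqOn hc' hx.1]
    refine (norm_add_le _ _).trans (add_le_add ?_ ?_)
    · exact (ContinuousLinearMap.le_opNorm _ _).trans
        (mul_le_mul hx.2.2 (hK e x hx.1) (norm_nonneg _) hL0)
    · rw [norm_mul]
      exact mul_le_mul_of_nonneg_right (hM e x hx.1) (norm_nonneg _)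
  map_add φ ψ := by
    obtain ⟨c, hc⟩ := T.exists_quad φ.2 e
    obtain ⟨d, hd⟩ := T.exists_quad ψ.2 e
    obtain ⟨L, hL0, hL⟩ := hD.ae_differentiableAt e
    have hcd : EqOn (φ + ψ : T.P2Space) (quad (c + d)) (T.elem e) := fun x hx => by
      rw [quad_add, ← hc (subset_closure hx), ← hd (subset_closure hx)]
      rfl
    filter_upwards [hL] with x hx
    rw [divDGrad_eq_of_eqOn (hc.mono subset_closure) hx.1 hx.2.1,
      divDGrad_eq_of_eqOn (hd.mono subset_closure) hx.1 hx.2.1,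
      divDGrad_eq_of_eqOn hcd hx.1 hx.2.1, quadGrad_add, map_add]
    simp only [Pi.add_apply]
    ring
  map_smul a φ := by
    obtain ⟨c, hc⟩ := T.exists_quad φ.2 e
    obtain ⟨L, hL0, hL⟩ := hD.ae_differentiableAt e
    have hac : EqOn (a • φ : T.P2Space) (quad (a • c)) (T.elem e) := fun x hx => by
      rw [quad_smul, ← hc (subset_closure hx)]
      rfl
    filter_upwards [hL] with x hx
    rw [divDGrad_eq_of_eqOn (hc.mono subset_closure) hx.1 hx.2.1,
      divDGrad_eq_of_eqOn hac hx.1 hx.2.1, quadGrad_smul, map_smul]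
    simp only [Pi.smul_apply, smul_eq_mul]
    ring

/-! ### The inverse inequality -/

/-- The coefficients of an affine function are controlled by its `L²` norm on an element. -/
theorem exists_norm_le_sqrt_integral_affine (T : Triangulation Ω) (e : Fin T.nel) :
    ∃ K : ℝ, 0 ≤ K ∧ ∀ a : Fin 3 → ℝ,
      ‖a‖ ≤ K * √(∫ x in T.elem e, (a 0 + a 1 * x 0 + a 2 * x 1) ^ 2) := by
  have hfin := T.isFiniteMeasure_elem e
  set F : (Fin 3 → ℝ) → Plane → ℝ := fun a x => a 0 + a 1 * x 0 + a 2 * x 1 with hF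
  have hcont : ∀ a, Continuous (F a) := fun a => by
    simp only [hF]
    fun_prop
  have hlin : IsL2Linear (volume.restrict (T.elem e)) F := by
    refine ⟨fun a => ?_, fun a b => .of_forall fun x => ?_, fun a b => .of_forall fun x => ?_⟩
    · obtain ⟨M, hM⟩ := (T.isCompact_closure_elem e).exists_bound_of_continuousOn
        (hcont a).continuousOn
      exact MemLp.of_bound (hcont a).aestronglyMeasurable M
        (ae_restrict_of_forall_mem (T.measurableSet_elem e) fun x hx => hM x (subset_closure hx))
    · simp only [hF, Pi.add_apply]
      ring
    · simp only [hF, Pi.smul_apply, smul_eq_mul]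
      ring
  have hker : hlin.toLp.ker = ⊥ := by
    rw [LinearMap.ker_eq_bot']
    intro a ha
    have h0 : F a =ᵐ[volume.restrict (T.elem e)] 0 := by
      refine (hlin.memLp a).coeFn_toLp.symm.trans ?_
      change (hlin.toLp a : Plane → ℝ) =ᵐ[_] 0
      rw [ha]
      exact Lp.coeFn_zero _ _ _
    have hz : EqOn (F a) 0 (T.elem e) := Measure.eqOn_open_of_ae_eq h0 (T.isOpen_elem e)
      (hcont a).continuousOn continuousOn_const
    obtain ⟨x, hx⟩ := T.nonempty_elem e
    have hstep : ∀ i : Fin 2, ∃ s : ℝ, s ≠ 0 ∧ x + s • EuclideanSpace.single i 1 ∈ T.elem e := by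
      intro i
      have hc : Continuous fun s : ℝ => x + s • EuclideanSpace.single i (1 : ℝ) := by fun_prop
      have hn : ∀ᶠ s in nhds (0 : ℝ), x + s • EuclideanSpace.single i (1 : ℝ) ∈ T.elem e :=
        hc.continuousAt.eventually ((T.isOpen_elem e).mem_nhds (by simpa using hx))
      have hn' := (hn.filter_mono nhdsWithin_le_nhds).and
        (eventually_mem_nhdsWithin (s := {(0 : ℝ)}ᶜ))
      obtain ⟨s, hs, hs'⟩ := hn'.exists
      exact ⟨s, hs', hs⟩
    have hx0 : a 0 + a 1 * x 0 + a 2 * x 1 = 0 := hz hx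
    obtain ⟨s, hs, hs'⟩ := hstep 0
    obtain ⟨t, ht, ht'⟩ := hstep 1
    have h1 := hz hs'
    have h2 := hz ht'
    simp [hF] at h1 h2
    have ha1 : a 1 = 0 := by
      have : a 1 * s = 0 := by linarith
      exact (mul_eq_zero.1 this).resolve_right hs
    have ha2 : a 2 = 0 := by
      have : a 2 * t = 0 := by linarith
      exact (mul_eq_zero.1 this).resolve_right ht
    have ha0 : a 0 = 0 := by simpa [ha1, ha2] using hx0
    ext i
    fin_cases i <;> assumption
  obtain ⟨K, -, hK⟩ := hlin.toLp.exists_antilipschitzWith hker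
  refine ⟨K, K.2, fun a => ?_⟩
  have h := hK.le_mul_dist a 0
  rw [map_zero, dist_zero_right, dist_zero_right] at h
  refine h.trans (le_of_eq ?_)
  congr 1
  change ‖(hlin.memLp a).toLp (F a)‖ = _
  rw [Lp.norm_toLp, (hlin.memLp a).toReal_eLpNorm_two]
  simp [hF]

theorem exists_integral_divDGrad_sq_le (hD : T.ElementwiseLipschitz D) (hΩ : IsOpen Ω)
    (e : Fin T.nel) : ∃ K : ℝ, 0 ≤ K ∧ ∀ φ ∈ T.P2Space,
      √(∫ x in T.elem e, divDGrad D φ x ^ 2) ≤ K * √(∫ x in T.elem e, ‖gradient φ x‖ ^ 2) := by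
  have := T.isFiniteMeasure_elem e
  obtain ⟨L, hL0, hL⟩ := hD.ae_differentiableAt e
  obtain ⟨M, hM0, hM⟩ := hD.exists_bound
  obtain ⟨K, hK0, hK⟩ := T.exists_norm_le_sqrt_integral_affine e
  set v := volume.real (T.elem e) with hv
  refine ⟨√(2 * L ^ 2 + 2 * (2 * M * K) ^ 2 * v), Real.sqrt_nonneg _, fun φ hφ => ?_⟩
  rw [← Real.sqrt_mul (by positivity)]
  refine Real.sqrt_le_sqrt ?_
  obtain ⟨c, hc⟩ := T.exists_quad hφ e
  have hc' := hc.mono subset_closure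
  have hgrad : MemLp (gradient φ) 2 (volume.restrict (T.elem e)) :=
    ((T.isL2Linear_gradient hΩ).memLp ⟨φ, hφ⟩).mono_measure (T.restrict_elem_le e)
  have hint : Integrable (fun x => ‖gradient φ x‖ ^ 2) (volume.restrict (T.elem e)) :=
    hgrad.norm.integrable_sq
  set G := ∫ x in T.elem e, ‖gradient φ x‖ ^ 2 with hG
  have hG0 : 0 ≤ G := integral_nonneg fun x => by positivity
  have haff : ∀ (i : Fin 2) (a : Fin 3 → ℝ),
      (∀ x : Plane, quadGrad c x i = a 0 + a 1 * x 0 + a 2 * x 1) → ‖a‖ ≤ K * √G := by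
    intro i a ha
    refine (hK a).trans (mul_le_mul_of_nonneg_left (Real.sqrt_le_sqrt ?_) hK0)
    refine integral_mono_of_nonneg (.of_forall fun x => sq_nonneg _) hint
      (ae_restrict_of_forall_mem (T.measurableSet_elem e) fun x hx => ?_)
    simp only
    rw [← ha, gradient_eq_of_eqOn hc' hx, ← sq_abs]
    exact pow_le_pow_left₀ (abs_nonneg _) (PiLp.norm_apply_le (quadGrad c x) i) 2
  have h3 : |2 * c 3| ≤ K * √G := (norm_le_pi_norm ![c 1, 2 * c 3, c 4] 1).trans
    (haff 0 _ fun x => by simp [quadGrad])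
  have h5 : |2 * c 5| ≤ K * √G := (norm_le_pi_norm ![c 2, c 4, 2 * c 5] 2).trans
    (haff 1 _ fun x => by simp [quadGrad])
  calc ∫ x in T.elem e, divDGrad D φ x ^ 2
      ≤ ∫ x in T.elem e, (2 * L ^ 2 * ‖gradient φ x‖ ^ 2 + 2 * (2 * M * K) ^ 2 * G) := by
        refine integral_mono_of_nonneg (.of_forall fun x => sq_nonneg _)
          ((hint.const_mul _).add (integrable_const _)) ?_
        filter_upwards [hL] with x hx
        rw [divDGrad_eq_of_eqOn hc' hx.1 hx.2.1, ← gradient_eq_of_eqOn hc' hx.1, ← sq_abs]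
        have hA : |fderiv ℝ D x (gradient φ x)| ≤ L * ‖gradient φ x‖ :=
          (ContinuousLinearMap.le_opNorm _ _).trans
            (mul_le_mul_of_nonneg_right hx.2.2 (norm_nonneg _))
        have hB : |D x * (2 * (c 3 + c 5))| ≤ 2 * M * K * √G := by
          rw [abs_mul, mul_add]
          calc |D x| * |2 * c 3 + 2 * c 5| ≤ M * (K * √G + K * √G) :=
                mul_le_mul (hM e x hx.1) ((abs_add_le _ _).trans (add_le_add h3 h5))
                  (abs_nonneg _) hM0
            _ = 2 * M * K * √G := by ring
        have hAB := (abs_add_le _ _).trans (add_le_add hA hB)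
        calc |fderiv ℝ D x (gradient φ x) + D x * (2 * (c 3 + c 5))| ^ 2
            ≤ (L * ‖gradient φ x‖ + 2 * M * K * √G) ^ 2 :=
              pow_le_pow_left₀ (abs_nonneg _) hAB 2
          _ ≤ 2 * ((L * ‖gradient φ x‖) ^ 2 + (2 * M * K * √G) ^ 2) := add_sq_le
          _ = 2 * L ^ 2 * ‖gradient φ x‖ ^ 2 + 2 * (2 * M * K) ^ 2 * √G ^ 2 := by ring
          _ = _ := by rw [Real.sq_sqrt hG0]
    _ = (2 * L ^ 2 + 2 * (2 * M * K) ^ 2 * v) * G := by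
        rw [integral_add (hint.const_mul _) (integrable_const _), integral_const_mul,
          setIntegral_const, smul_eq_mul]
        ring

theorem exists_isInverseConstant (hD : T.ElementwiseLipschitz D) (hΩ : IsOpen Ω)
    (h1 : ∀ᵐ x ∂(volume.restrict Ω), 1 ≤ D x) : ∃ C, T.IsInverseConstant D C := by
  choose K hK0 hK using exists_integral_divDGrad_sq_le hD hΩ
  obtain ⟨M, hM⟩ := (finite_range fun e => K e * T.size e / supNorm (T.elem e) D).bddAbove
  refine ⟨max M 1, by positivity, fun φ hφ e => (hK e φ hφ).trans ?_⟩
  refine mul_le_mul_of_nonneg_right ?_ (Real.sqrt_nonneg _)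
  have hs := T.size_pos e
  have hn := hD.supNorm_elem_pos hΩ h1 e
  have h := (hM ⟨e, rfl⟩).trans (le_max_left M 1)
  simp only at h
  rw [div_le_iff₀ hn] at h
  rw [div_mul_eq_mul_div, le_div_iff₀ hs]
  exact h

end Triangulation

/-! ### Products with functions of class `H¹₀` -/

theorem gradient_apply (f : Plane → ℝ) (x : Plane) (i : Fin 2) :
    gradient f x i = fderiv ℝ f x (EuclideanSpace.single i 1) := by
  rw [← inner_gradient_left, EuclideanSpace.inner_single_right]
  simp

theorem gradient_fun_mul {f g : Plane → ℝ} {x : Plane} (hf : DifferentiableAt ℝ f x)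
    (hg : DifferentiableAt ℝ g x) :
    gradient (fun y => f y * g y) x = f x • gradient g x + g x • gradient f x := by
  ext i
  simp only [PiLp.add_apply, PiLp.smul_apply, gradient_apply, smul_eq_mul]
  rw [(hf.hasFDerivAt.fun_mul hg.hasFDerivAt).fderiv]
  rfl

theorem IsTestFunction.differentiable {Ω : Set Plane} {η : Plane → ℝ} (hη : IsTestFunction Ω η) :
    Differentiable ℝ η := hη.1.differentiable (by simp)

theorem IsTestFunction.memLp {Ω : Set Plane} {η : Plane → ℝ} (hη : IsTestFunction Ω η) :
    MemLp η 2 (volume.restrict Ω) :=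
  (hη.1.continuous.memLp_of_hasCompactSupport hη.2.1).restrict _

theorem IsTestFunction.memLp_gradient {Ω : Set Plane} {η : Plane → ℝ}
    (hη : IsTestFunction Ω η) : MemLp (gradient η) 2 (volume.restrict Ω) := by
  have hc : Continuous (gradient η) := (InnerProductSpace.toDual ℝ Plane).symm.continuous.comp
    (hη.1.continuous_fderiv (by simp))
  have hs : HasCompactSupport (gradient η) :=
    (hη.2.1.fderiv ℝ).comp_left (map_zero (InnerProductSpace.toDual ℝ Plane).symm)
  exact (hc.memLp_of_hasCompactSupport hs).restrict _

namespace Triangulation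

variable {Ω : Set Plane} {T : Triangulation Ω} {w : Plane → ℝ}

namespace PiecewiseC1

theorem exists_lipschitzWith_mul (hw : T.PiecewiseC1 w) (hΩ : IsOpen Ω) {η : Plane → ℝ}
    (hη : IsTestFunction Ω η) : ∃ C, LipschitzWith C fun x => η x * w x := by
  have h : ∀ e, ∃ C, LipschitzOnWith C (fun x => η x * w x) (closure (T.elem e)) := fun e => by
    obtain ⟨q, hq, hwq⟩ := hw e
    obtain ⟨C, hC⟩ := ContDiff.lipschitzWith_of_hasCompactSupport (𝕂 := ℝ)
      (f := fun x => η x * q x) hη.2.1.mul_right ((hη.1.of_le (by exact_mod_cast le_top)).mul hq)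
      one_ne_zero
    refine ⟨C, fun x hx y hy => ?_⟩
    simp only [hwq hx, hwq hy]
    exact hC x y
  choose C hC using h
  refine ⟨∑ e, C e, lipschitzWith_of_finite_closed_cover (ι := Option (Fin T.nel))
    (S := fun o => o.elim Ωᶜ fun e => closure (T.elem e)) ?_ ?_ ?_⟩
  · rintro (_ | e)
    · exact hΩ.isClosed_compl
    · exact isClosed_closure
  · refine eq_univ_of_forall fun x => ?_
    by_cases hx : x ∈ Ω
    · have hx' := subset_closure hx
      rw [T.closure_eq_iUnion] at hx'
      obtain ⟨e, he⟩ := mem_iUnion.1 hx'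
      exact mem_iUnion.2 ⟨some e, he⟩
    · exact mem_iUnion.2 ⟨none, hx⟩
  · rintro (_ | e)
    · have h0 : ∀ x ∈ Ωᶜ, η x = 0 := fun x hx =>
        image_eq_zero_of_notMem_tsupport fun h => hx (hη.2.2 h)
      intro x hx y hy
      simp [h0 x hx, h0 y hy]
    · exact (hC e).weaken (Finset.single_le_sum (f := C) (fun _ _ => zero_le) (Finset.mem_univ e))

theorem hasCompactSupport_mul {η : Plane → ℝ} (hη : IsTestFunction Ω η) :
    HasCompactSupport fun x => η x * w x := hη.2.1.mul_right

theorem lineDeriv_mul (hw : T.PiecewiseC1 w) {η : Plane → ℝ} (hη : IsTestFunction Ω η)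
    {e : Fin T.nel} {x : Plane} (hx : x ∈ T.elem e) (i : Fin 2) :
    lineDeriv ℝ (fun x => η x * w x) x (EuclideanSpace.single i 1) =
      η x * gradient w x i + gradient η x i * w x := by
  have h1 := hη.differentiable x
  have h2 := hw.differentiableAt hx
  rw [(h1.fun_mul h2).lineDeriv_eq_fderiv, ← gradient_apply, gradient_fun_mul h1 h2]
  simp [mul_comm]

theorem lineDeriv_mul_eq_zero {η : Plane → ℝ} (hη : IsTestFunction Ω η)
    {x : Plane} (hx : x ∉ Ω) (v : Plane) : lineDeriv ℝ (fun x => η x * w x) x v = 0 := by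
  have h0 : (fun x => η x * w x) =ᶠ[nhds x] fun _ => 0 := by
    have := (notMem_tsupport_iff_eventuallyEq (f := η)).1 fun h => hx (hη.2.2 h)
    filter_upwards [this] with y hy
    simp [hy]
  rw [h0.lineDeriv_eq]
  simp [lineDeriv]

/-- Integration by parts against a test function. -/
theorem integral_mul_gradient_add (hw : T.PiecewiseC1 w) (hΩ : IsOpen Ω) {η : Plane → ℝ}
    (hη : IsTestFunction Ω η) (i : Fin 2) :
    ∫ x in Ω, (η x * gradient w x i + gradient η x i * w x) = 0 := by
  obtain ⟨C, hC⟩ := hw.exists_lipschitzWith_mul hΩ hη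
  rw [← hC.integral_lineDeriv_eq_zero (hasCompactSupport_mul hη) (EuclideanSpace.single i 1),
    ← setIntegral_eq_integral_of_forall_compl_eq_zero
      fun x hx => lineDeriv_mul_eq_zero (w := w) hη hx _]
  exact integral_congr_ae (T.ae_of_forall_elem fun e x hx => (hw.lineDeriv_mul hη hx i).symm)

theorem eLpNorm_testFunction_mul_le (hw : T.PiecewiseC1 w) (hΩ : IsOpen Ω) {η : Plane → ℝ}
    (hη : IsTestFunction Ω η) :
    eLpNorm (fun x => η x * w x) 2 (volume.restrict Ω) ≤
      2 * (eLpNorm η 2 (volume.restrict Ω) * eLpNorm (gradient w) 2 (volume.restrict Ω) +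
        eLpNorm w 2 (volume.restrict Ω) * eLpNorm (gradient η) 2 (volume.restrict Ω)) := by
  set μ := volume.restrict Ω with hμ
  obtain ⟨C, hC⟩ := hw.exists_lipschitzWith_mul hΩ hη
  have h1 := hC.lintegral_sq_le_sq_lintegral_lineDeriv (hasCompactSupport_mul hη)
  have h2 : eLpNorm (fun x => η x * w x) 2 μ ^ 2 ≤ ∫⁻ x, ‖η x * w x‖ₑ ^ 2 := by
    have := eLpNorm_nnreal_pow_eq_lintegral (f := fun x => η x * w x) (μ := μ) (p := 2) two_ne_zero
    simp only [NNReal.coe_ofNat, ENNReal.coe_ofNat, ENNReal.rpow_ofNat] at this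
    rw [this]
    exact setLIntegral_le_lintegral _ _
  have h3 := (ENNReal.pow_le_pow_left_iff two_ne_zero).1 (h2.trans h1)
  refine h3.trans ?_
  have hcomp : ∀ (v : Plane) (i : Fin 2), ‖v i‖ₑ ≤ ‖v‖ₑ := fun v i => by
    rw [← ofReal_norm, ← ofReal_norm]
    exact ENNReal.ofReal_le_ofReal (PiLp.norm_apply_le v i)
  calc ∫⁻ x, ∑ i : Fin 2, ‖lineDeriv ℝ (fun x => η x * w x) x (EuclideanSpace.single i 1)‖ₑ
      = ∫⁻ x in Ω, ∑ i : Fin 2,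
          ‖lineDeriv ℝ (fun x => η x * w x) x (EuclideanSpace.single i 1)‖ₑ := by
        refine (setLIntegral_eq_of_support_subset ?_).symm
        intro x hx
        by_contra hxΩ
        exact hx (by simp [lineDeriv_mul_eq_zero (w := w) hη hxΩ])
    _ ≤ ∫⁻ x in Ω, 2 * (‖(η • gradient w) x‖ₑ + ‖(w • gradient η) x‖ₑ) := by
        refine lintegral_mono_ae (T.ae_of_forall_elem fun e x hx => ?_)
        have : ∀ i ∈ Finset.univ, ‖lineDeriv ℝ (fun x => η x * w x) x
            (EuclideanSpace.single i 1)‖ₑ ≤ ‖(η • gradient w) x‖ₑ + ‖(w • gradient η) x‖ₑ := by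
          intro i _
          rw [hw.lineDeriv_mul hη hx]
          refine (enorm_add_le _ _).trans (add_le_add ?_ ?_)
          · exact hcomp ((η • gradient w) x) i
          · rw [mul_comm]
            exact hcomp ((w • gradient η) x) i
        refine (Finset.sum_le_sum this).trans (le_of_eq ?_)
        rw [Fin.sum_univ_two, two_mul]
    _ = 2 * (eLpNorm (η • gradient w) 1 μ + eLpNorm (w • gradient η) 1 μ) := by
        rw [lintegral_const_mul' _ _ (by simp), lintegral_add_left, eLpNorm_one_eq_lintegral_enorm,
          eLpNorm_one_eq_lintegral_enorm]
        exact (hη.1.continuous.measurable.smul (measurable_gradient w)).enorm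
    _ ≤ _ := by
        gcongr
        · exact eLpNorm_smul_le_mul_eLpNorm (measurable_gradient w).aestronglyMeasurable
            hη.memLp.1
        · exact eLpNorm_smul_le_mul_eLpNorm (measurable_gradient η).aestronglyMeasurable
            (hw.memLp hΩ).1

end PiecewiseC1

end Triangulation

theorem ENNReal.le_of_forall_le_add_mul {a b c : ENNReal} (hc : c ≠ ⊤)
    (h : ∀ r : ENNReal, 0 < r → a ≤ b + r * c) : a ≤ b := by
  have ht : Filter.Tendsto (fun r : ENNReal => b + r * c) (nhdsWithin 0 (Ioi 0)) (nhds b) := by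
    have h1 : Filter.Tendsto (fun r : ENNReal => r * c) (nhds 0) (nhds (0 * c)) :=
      ENNReal.Tendsto.mul_const Filter.tendsto_id (Or.inr hc)
    have h2 := (tendsto_const_nhds (x := b)).add h1
    rw [zero_mul, add_zero] at h2
    exact h2.mono_left nhdsWithin_le_nhds
  exact ge_of_tendsto ht (Filter.eventually_of_mem self_mem_nhdsWithin h)

namespace Triangulation.PiecewiseC1

variable {Ω : Set Plane} {T : Triangulation Ω} {w : Plane → ℝ}

/-- The product of a function of class `H¹₀` and a piecewise smooth function is square integrable,
with a bound which does not depend on the domain. -/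
theorem eLpNorm_mul_le (hw : T.PiecewiseC1 w) (hΩ : IsOpen Ω) {v : Plane → ℝ}
    {g : Plane → Plane} (hv : MemH10 Ω v g) :
    eLpNorm (fun x => v x * w x) 2 (volume.restrict Ω) ≤
      2 * (eLpNorm v 2 (volume.restrict Ω) * eLpNorm (gradient w) 2 (volume.restrict Ω) +
        eLpNorm w 2 (volume.restrict Ω) * eLpNorm g 2 (volume.restrict Ω)) := by
  obtain ⟨M, hM0, hM⟩ := hw.exists_bound
  set μ := volume.restrict Ω with hμ
  have hwL := hw.memLp hΩ
  have hgwL := hw.memLp_gradient hΩ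
  refine ENNReal.le_of_forall_le_add_mul
    (c := 2 * (eLpNorm (gradient w) 2 μ + eLpNorm w 2 μ) + ENNReal.ofReal M) ?_ fun r hr => ?_
  · finiteness [hwL.2, hgwL.2]
  obtain ⟨η, hη, hr1, hr2⟩ := hv.approx r hr
  have hη1 : eLpNorm η 2 μ ≤ eLpNorm v 2 μ + r := by
    have := eLpNorm_add_le hv.memLp.1 (hη.memLp.1.sub hv.memLp.1) (p := 2) (by norm_num)
    rw [add_sub_cancel] at this
    exact this.trans (add_le_add le_rfl hr1)
  have hη2 : eLpNorm (gradient η) 2 μ ≤ eLpNorm g 2 μ + r := by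
    have := eLpNorm_add_le hv.memLp_grad.1 (hη.memLp_gradient.1.sub hv.memLp_grad.1) (p := 2)
      (by norm_num)
    rw [add_sub_cancel] at this
    exact this.trans (add_le_add le_rfl hr2)
  have hsub : eLpNorm (fun x => (η x - v x) * w x) 2 μ ≤ r * ENNReal.ofReal M := by
    refine (eLpNorm_le_mul_eLpNorm_of_ae_le_mul (f := fun x => (η x - v x) * w x)
      (g := fun x => η x - v x) (c := M) ?_ 2).trans ?_
    · filter_upwards [ae_restrict_mem hΩ.measurableSet] with x hx
      rw [norm_mul, mul_comm]
      exact mul_le_mul_of_nonneg_right (hM x (subset_closure hx)) (norm_nonneg _)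
    · rw [mul_comm]
      exact mul_le_mul_left hr1 _
  have hsplit : (fun x => v x * w x) =
      (fun x => η x * w x) - fun x => (η x - v x) * w x := by
    funext x
    simp only [Pi.sub_apply]
    ring
  calc eLpNorm (fun x => v x * w x) 2 μ
      ≤ eLpNorm (fun x => η x * w x) 2 μ + eLpNorm (fun x => (η x - v x) * w x) 2 μ := by
        rw [hsplit]
        exact eLpNorm_sub_le (hη.memLp.1.mul hwL.1)
          ((hη.memLp.1.sub hv.memLp.1).mul hwL.1) (by norm_num)
    _ ≤ 2 * ((eLpNorm v 2 μ + r) * eLpNorm (gradient w) 2 μ +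
          eLpNorm w 2 μ * (eLpNorm g 2 μ + r)) + r * ENNReal.ofReal M := by
        refine add_le_add ((hw.eLpNorm_testFunction_mul_le hΩ hη).trans ?_) hsub
        gcongr
    _ = _ := by ring

theorem memLp_mul (hw : T.PiecewiseC1 w) (hΩ : IsOpen Ω) {v : Plane → ℝ}
    {g : Plane → Plane} (hv : MemH10 Ω v g) :
    MemLp (fun x => v x * w x) 2 (volume.restrict Ω) := by
  refine ⟨hv.memLp.1.mul (hw.memLp hΩ).1, (hw.eLpNorm_mul_le hΩ hv).trans_lt ?_⟩
  have h1 := hv.memLp.2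
  have h2 := hv.memLp_grad.2
  have h3 := (hw.memLp hΩ).2
  have h4 := (hw.memLp_gradient hΩ).2
  finiteness

theorem sqrt_integral_mul_sq_le (hw : T.PiecewiseC1 w) (hΩ : IsOpen Ω) {v : Plane → ℝ}
    {g : Plane → Plane} (hv : MemH10 Ω v g) :
    √(∫ x in Ω, (v x * w x) ^ 2) ≤
      2 * (√(∫ x in Ω, v x ^ 2) * √(∫ x in Ω, ‖gradient w x‖ ^ 2) +
        √(∫ x in Ω, w x ^ 2) * √(∫ x in Ω, ‖g x‖ ^ 2)) := by
  have h1 := hv.memLp.2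
  have h2 := hv.memLp_grad.2
  have h3 := (hw.memLp hΩ).2
  have h4 := (hw.memLp_gradient hΩ).2
  have h := ENNReal.toReal_mono (by finiteness) (hw.eLpNorm_mul_le hΩ hv)
  rw [ENNReal.toReal_mul, ENNReal.toReal_add (by finiteness) (by finiteness), ENNReal.toReal_mul,
    ENNReal.toReal_mul, (hw.memLp_mul hΩ hv).toReal_eLpNorm_two, hv.memLp.toReal_eLpNorm_two,
    hv.memLp_grad.toReal_eLpNorm_two, (hw.memLp hΩ).toReal_eLpNorm_two,
    (hw.memLp_gradient hΩ).toReal_eLpNorm_two] at h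
  simpa only [Real.norm_eq_abs, sq_abs, ENNReal.toReal_ofNat] using h

/-- Integration by parts for functions of class `H¹₀`. -/
theorem integral_mul_gradient_add_of_memH10 (hw : T.PiecewiseC1 w) (hΩ : IsOpen Ω) {v : Plane → ℝ}
    {g : Plane → Plane} (hv : MemH10 Ω v g) (i : Fin 2) :
    ∫ x in Ω, (v x * gradient w x i + g x i * w x) = 0 := by
  set μ := volume.restrict Ω with hμ
  have hwL := hw.memLp hΩ
  have hgwL := (hw.memLp_gradient hΩ).eval_piLp i
  set K := √(∫ x in Ω, gradient w x i ^ 2) + √(∫ x in Ω, w x ^ 2) with hK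
  have hbound : ∀ r : NNReal, 0 < r →
      |∫ x in Ω, (v x * gradient w x i + g x i * w x)| ≤ r * K := by
    intro r hr
    obtain ⟨η, hη, hr1, hr2⟩ := hv.approx r (by exact_mod_cast hr)
    have hd : MemLp (fun x => η x - v x) 2 μ := hη.memLp.sub hv.memLp
    have hdg : MemLp (fun x => gradient η x - g x) 2 μ := hη.memLp_gradient.sub hv.memLp_grad
    have hdgi := hdg.eval_piLp i
    have hr1' : √(∫ x in Ω, (η x - v x) ^ 2) ≤ r := by
      have := ENNReal.toReal_mono (by simp) hr1
      rw [hd.toReal_eLpNorm_two] at this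
      simpa only [Real.norm_eq_abs, sq_abs, ENNReal.coe_toReal] using this
    have hr2' : √(∫ x in Ω, (gradient η x i - g x i) ^ 2) ≤ r := by
      have := ENNReal.toReal_mono (by simp) ((eLpNorm_mono fun x => PiLp.norm_apply_le
        (gradient η x - g x) i).trans hr2)
      rw [hdgi.toReal_eLpNorm_two] at this
      simpa only [Real.norm_eq_abs, sq_abs, ENNReal.coe_toReal, PiLp.sub_apply] using this
    have hi1 : Integrable (fun x => (η x - v x) * gradient w x i) μ := hd.integrable_mul hgwL
    have hi2 : Integrable (fun x => (gradient η x i - g x i) * w x) μ := hdgi.integrable_mul hwL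
    have hi3 : Integrable (fun x => η x * gradient w x i + gradient η x i * w x) μ :=
      (hη.memLp.integrable_mul hgwL).add ((hη.memLp_gradient.eval_piLp i).integrable_mul hwL)
    have heq : ∫ x in Ω, (v x * gradient w x i + g x i * w x) =
        -(∫ x in Ω, (η x - v x) * gradient w x i) - ∫ x in Ω, (gradient η x i - g x i) * w x := by
      have h0 := hw.integral_mul_gradient_add hΩ hη i
      have h1 := integral_sub hi3 (hi1.add hi2)
      simp only [Pi.add_apply] at h1
      rw [integral_add hi1 hi2, h0] at h1
      have h2 : ∫ x in Ω, (v x * gradient w x i + g x i * w x) =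
          ∫ x in Ω, ((η x * gradient w x i + gradient η x i * w x) -
            ((η x - v x) * gradient w x i + (gradient η x i - g x i) * w x)) := by
        congr 1
        funext x
        ring
      rw [h2, h1]
      ring
    rw [heq]
    calc _ ≤ |∫ x in Ω, (η x - v x) * gradient w x i| +
          |∫ x in Ω, (gradient η x i - g x i) * w x| := by
          rw [← abs_neg (∫ x in Ω, (η x - v x) * gradient w x i)]
          exact abs_sub _ _
      _ ≤ r * √(∫ x in Ω, gradient w x i ^ 2) + r * √(∫ x in Ω, w x ^ 2) :=
          add_le_add
            ((abs_integral_mul_le hd hgwL).trans (mul_le_mul_of_nonneg_right hr1' (by positivity)))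
            ((abs_integral_mul_le hdgi hwL).trans (mul_le_mul_of_nonneg_right hr2' (by positivity)))
      _ = r * K := by rw [hK]; ring
  refine abs_eq_zero.1 (le_antisymm (le_of_forall_pos_le_add fun ε hε => ?_) (abs_nonneg _))
  have hK0 : 0 ≤ K := by positivity
  refine (hbound (ε / (K + 1)).toNNReal (Real.toNNReal_pos.2 (by positivity))).trans ?_
  rw [zero_add, Real.coe_toNNReal _ (by positivity), div_mul_eq_mul_div,
    div_le_iff₀ (by positivity)]
  nlinarith

end Triangulation.PiecewiseC1

/-! ### The convection term -/

namespace IsVelocity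

variable {Ω : Set Plane} {T : Triangulation Ω} {w : Plane → ℝ} {u : Plane → Plane}
  {G : Fin 2 → Plane → Plane}

theorem integral_inner_gradient_eq_zero (hu : IsVelocity Ω u G) (hΩ : IsOpen Ω)
    (hw : T.PiecewiseC1 w) : ∫ x in Ω, inner ℝ (u x) (gradient w x) = 0 := by
  have hwL := hw.memLp hΩ
  have hgw := hw.memLp_gradient hΩ
  have h0 : ∀ i : Fin 2, ∫ x in Ω, (u x i * gradient w x i + G i x i * w x) = 0 := fun i =>
    hw.integral_mul_gradient_add_of_memH10 hΩ (hu.memH10 i) i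
  have hi : ∀ i ∈ Finset.univ, Integrable (fun x => u x i * gradient w x i + G i x i * w x)
      (volume.restrict Ω) := fun i _ =>
    ((hu.memH10 i).memLp.integrable_mul
      (hgw.eval_piLp i)).add
      (((hu.memH10 i).memLp_grad.eval_piLp i).integrable_mul hwL)
  have hsum := integral_finsetSum Finset.univ hi
  simp only [h0, Finset.sum_const_zero] at hsum
  rw [← hsum]
  refine integral_congr_ae ?_
  filter_upwards [hu.divFree] with x hx
  rw [Finset.sum_add_distrib, ← Finset.sum_mul, hx, zero_mul, add_zero, PiLp.inner_apply]
  simp [mul_comm]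

theorem sq_velocityNorm (hu : IsVelocity Ω u G) : velocityNorm Ω u G ^ 2 =
    ∑ i, ((∫ x in Ω, u x i ^ 2) + ∫ x in Ω, ‖G i x‖ ^ 2) := by
  rw [velocityNorm, Real.sq_sqrt (by positivity), Finset.sum_add_distrib,
    ← integral_finsetSum _ fun i _ => (hu.memH10 i).memLp.integrable_sq]
  congr 2
  funext x
  rw [EuclideanSpace.real_norm_sq_eq]

theorem memLp_smul (hu : IsVelocity Ω u G) (hΩ : IsOpen Ω) (hw : T.PiecewiseC1 w) :
    MemLp (fun x => w x • u x) 2 (volume.restrict Ω) := by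
  refine MemLp.of_eval_piLp fun i => ?_
  simpa [mul_comm] using hw.memLp_mul hΩ (hu.memH10 i)

theorem integral_norm_smul_sq_le (hu : IsVelocity Ω u G) (hΩ : IsOpen Ω) (hw : T.PiecewiseC1 w) :
    ∫ x in Ω, ‖w x • u x‖ ^ 2 ≤ (2 * velocityNorm Ω u G) ^ 2 *
      ((∫ x in Ω, ‖gradient w x‖ ^ 2) + ∫ x in Ω, w x ^ 2) := by
  have hA0 : 0 ≤ ∫ x in Ω, ‖gradient w x‖ ^ 2 := by positivity
  have hB0 : 0 ≤ ∫ x in Ω, w x ^ 2 := by positivity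
  have hterm : ∀ i : Fin 2, ∫ x in Ω, (u x i * w x) ^ 2 ≤
      4 * (((∫ x in Ω, u x i ^ 2) + ∫ x in Ω, ‖G i x‖ ^ 2) *
        ((∫ x in Ω, ‖gradient w x‖ ^ 2) + ∫ x in Ω, w x ^ 2)) := by
    intro i
    have ha0 : 0 ≤ ∫ x in Ω, u x i ^ 2 := by positivity
    have hb0 : 0 ≤ ∫ x in Ω, ‖G i x‖ ^ 2 := by positivity
    have h := hw.sqrt_integral_mul_sq_le hΩ (hu.memH10 i)
    rw [Real.sqrt_le_left (by positivity)] at h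
    refine h.trans ?_
    rw [← Real.sq_sqrt hA0, ← Real.sq_sqrt hB0, ← Real.sq_sqrt ha0, ← Real.sq_sqrt hb0]
    simp only [Real.sqrt_sq (Real.sqrt_nonneg _)]
    nlinarith [sq_nonneg (√(∫ x in Ω, u x i ^ 2) * √(∫ x in Ω, w x ^ 2) -
      √(∫ x in Ω, ‖G i x‖ ^ 2) * √(∫ x in Ω, ‖gradient w x‖ ^ 2))]
  calc ∫ x in Ω, ‖w x • u x‖ ^ 2 = ∑ i : Fin 2, ∫ x in Ω, (u x i * w x) ^ 2 := by
        rw [← integral_finsetSum _ fun i _ => (hw.memLp_mul hΩ (hu.memH10 i)).integrable_sq]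
        congr 1
        funext x
        rw [EuclideanSpace.real_norm_sq_eq]
        simp [mul_comm]
    _ ≤ _ := Finset.sum_le_sum fun i _ => hterm i
    _ = _ := by
        rw [mul_pow, hu.sq_velocityNorm, ← Finset.mul_sum, ← Finset.sum_mul]
        ring

/-- The convection term is bounded, with a constant which does not depend on the domain. -/
theorem abs_integral_convection_le (hu : IsVelocity Ω u G) (hΩ : IsOpen Ω)
    (hw : T.PiecewiseC1 w) {g : Plane → Plane} (hg : MemLp g 2 (volume.restrict Ω)) :
    |∫ x in Ω, inner ℝ (u x) (g x) * w x| ≤ 2 * velocityNorm Ω u G *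
      √((∫ x in Ω, ‖gradient w x‖ ^ 2) + ∫ x in Ω, w x ^ 2) * √(∫ x in Ω, ‖g x‖ ^ 2) := by
  have h := abs_integral_inner_le (hu.memLp_smul hΩ hw) hg
  simp only [real_inner_smul_left, mul_comm (w _)] at h
  refine h.trans (mul_le_mul_of_nonneg_right ?_ (Real.sqrt_nonneg _))
  have h0 : 0 ≤ velocityNorm Ω u G := Real.sqrt_nonneg _
  rw [← Real.sqrt_sq (show 0 ≤ 2 * velocityNorm Ω u G by positivity),
    ← Real.sqrt_mul (sq_nonneg _)]
  exact Real.sqrt_le_sqrt (hu.integral_norm_smul_sq_le hΩ hw)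

theorem integral_convection_self_eq_zero (hu : IsVelocity Ω u G) (hΩ : IsOpen Ω)
    (hw : T.PiecewiseC1 w) : ∫ x in Ω, inner ℝ (u x) (gradient w x) * w x = 0 := by
  have h := hu.integral_inner_gradient_eq_zero hΩ (hw.mul hw)
  have h2 : ∫ x in Ω, inner ℝ (u x) (gradient (fun y => w y * w y) x) =
      ∫ x in Ω, 2 * (inner ℝ (u x) (gradient w x) * w x) := by
    refine integral_congr_ae (T.ae_of_forall_elem fun e x hx => ?_)
    have hd := hw.differentiableAt hx
    beta_reduce
    rw [gradient_fun_mul hd hd, inner_add_right, inner_smul_right]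
    ring
  rw [h2, integral_const_mul] at h
  linarith

end IsVelocity

/-! ### The stabilized problem -/

namespace Triangulation

variable {Ω : Set Plane} {T : Triangulation Ω} {u : Plane → Plane} {D : Plane → ℝ}
  {δ : Fin T.nel → ℝ} {ε π₁ : ℝ} {φ ψ : Plane → ℝ}

theorem supgSpace_le (T : Triangulation Ω) (u : Plane → Plane) : T.supgSpace u ≤ T.P2Space :=
  fun _ h => h.1

theorem finiteDimensional_supgSpace (T : Triangulation Ω) (u : Plane → Plane) :
    FiniteDimensional ℝ (T.supgSpace u) :=
  have := T.finiteDimensional_P2Space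
  Submodule.finiteDimensional_of_le (T.supgSpace_le u)

theorem sq_supgNorm (hε : 0 ≤ ε) (hπ₁ : 0 ≤ π₁) (φ : Plane → ℝ) :
    T.supgNorm u δ ε π₁ φ ^ 2 = π₁ * (∫ x in Ω, ‖gradient φ x‖ ^ 2) + ε * (∫ x in Ω, φ x ^ 2)
      + ∑ e, ∫ x in T.elem e, (√(δ e) * inner ℝ (u x) (gradient φ x)) ^ 2 :=
  Real.sq_sqrt (by positivity)

theorem supgNorm_nonneg (φ : Plane → ℝ) : 0 ≤ T.supgNorm u δ ε π₁ φ := Real.sqrt_nonneg _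

theorem eq_zero_of_supgNorm_eq_zero (hΩ : IsOpen Ω) (hε : 0 < ε) (hπ₁ : 0 ≤ π₁)
    (hφ : φ ∈ T.P2Space) (h : T.supgNorm u δ ε π₁ φ = 0) : φ = 0 := by
  have h2 := sq_supgNorm (u := u) (δ := δ) hε.le hπ₁ φ
  have hA : 0 ≤ π₁ * ∫ x in Ω, ‖gradient φ x‖ ^ 2 := by positivity
  have hS : 0 ≤ ∑ e, ∫ x in T.elem e, (√(δ e) * inner ℝ (u x) (gradient φ x)) ^ 2 := by positivity
  have hB : 0 ≤ ∫ x in Ω, φ x ^ 2 := by positivity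
  rw [h] at h2
  have h3 : ∫ x in Ω, φ x ^ 2 = 0 := by nlinarith
  have hint := ((piecewiseC1_of_mem_P2Space hφ).memLp hΩ).integrable_sq
  have h4 := (integral_eq_zero_iff_of_nonneg (fun x => sq_nonneg (φ x)) hint).1 h3
  have h5 : φ =ᵐ[volume.restrict Ω] 0 := h4.mono fun x hx => pow_eq_zero_iff two_ne_zero |>.1 hx
  have h6 : EqOn φ 0 Ω := Measure.eqOn_open_of_ae_eq h5 hΩ (hφ.1.mono subset_closure)
    continuousOn_const
  have h7 : EqOn φ 0 (closure Ω) :=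
    h6.of_subset_closure hφ.1 continuousOn_const subset_closure le_rfl
  funext x
  by_cases hx : x ∈ closure Ω
  · exact h7 hx
  · exact hφ.2.1 x hx

/-! #### Bilinearity -/

theorem exists_bilin_galerkinForm (hΩ : IsOpen Ω) (hD : T.ElementwiseLipschitz D) :
    ∃ a : T.supgSpace u →ₗ[ℝ] T.supgSpace u →ₗ[ℝ] ℝ,
      ∀ φ ψ, a φ ψ = galerkinForm Ω u D ε π₁ φ ψ := by
  let J := Submodule.inclusion (T.supgSpace_le u)
  have h0 := (T.isL2Linear_coe hΩ).comp J
  have h1 := (T.isL2Linear_gradient hΩ).comp J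
  obtain ⟨a₁, ha₁⟩ := (T.isL2Linear_convection (u := u)).exists_bilin h0
  obtain ⟨a₂, ha₂⟩ := (isL2Linear_smul hΩ hD h1).exists_bilin h1
  obtain ⟨a₃, ha₃⟩ := h0.exists_bilin h0
  refine ⟨a₁ + π₁ • a₂ + ε • a₃, fun φ ψ => ?_⟩
  simp [galerkinForm, ha₁, ha₂, ha₃, J, mul_comm]

theorem isL2Linear_residual (hΩ : IsOpen Ω) (hD : T.ElementwiseLipschitz D) (ε π₁ : ℝ)
    (e : Fin T.nel) : IsL2Linear (volume.restrict (T.elem e)) fun (φ : T.supgSpace u) x =>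
      inner ℝ (u x) (gradient (φ : Plane → ℝ) x) + ε * (φ : Plane → ℝ) x - π₁ * divDGrad D φ x := by
  let J := Submodule.inclusion (T.supgSpace_le u)
  have h := ((T.isL2Linear_convection (u := u)).mono_measure (T.restrict_elem_le e)).add
    ((((T.isL2Linear_coe hΩ).comp J).mono_measure (T.restrict_elem_le e)).const_smul ε) |>.add
    (((isL2Linear_divDGrad hD e).comp J).const_smul (-π₁))
  simpa [J, sub_eq_add_neg] using h

theorem exists_bilin_supgForm (hΩ : IsOpen Ω) (hD : T.ElementwiseLipschitz D) :
    ∃ a : T.supgSpace u →ₗ[ℝ] T.supgSpace u →ₗ[ℝ] ℝ,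
      ∀ φ ψ, a φ ψ = T.supgForm u D δ ε π₁ φ ψ := by
  obtain ⟨a₀, ha₀⟩ := exists_bilin_galerkinForm (u := u) (ε := ε) (π₁ := π₁) hΩ hD
  have h : ∀ e, ∃ B : T.supgSpace u →ₗ[ℝ] T.supgSpace u →ₗ[ℝ] ℝ, ∀ φ ψ, B φ ψ =
      ∫ x in T.elem e, δ e * (inner ℝ (u x) (gradient (φ : Plane → ℝ) x) + ε * (φ : Plane → ℝ) x
        - π₁ * divDGrad D φ x) * inner ℝ (u x) (gradient (ψ : Plane → ℝ) x) := by
    intro e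
    obtain ⟨B, hB⟩ := ((isL2Linear_residual hΩ hD ε π₁ e).const_smul (δ e)).exists_bilin
      ((T.isL2Linear_convection (u := u)).mono_measure (T.restrict_elem_le e))
    refine ⟨B, fun φ ψ => ?_⟩
    rw [hB]
    simp [mul_comm]
  choose B hB using h
  refine ⟨a₀ + ∑ e, B e, fun φ ψ => ?_⟩
  simp [supgForm, ha₀, hB, LinearMap.sum_apply]

theorem exists_linear_supgLoad (hΩ : IsOpen Ω) {Dθ θ : Plane → ℝ}
    (hD : T.ElementwiseLipschitz Dθ) (hθ : θ ∈ T.P2Space) (π₂ : ℝ) :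
    ∃ b : T.supgSpace u →ₗ[ℝ] ℝ, ∀ ψ, b ψ = T.supgLoad u Dθ θ δ π₂ ψ := by
  let J := Submodule.inclusion (T.supgSpace_le u)
  obtain ⟨b₀, hb₀⟩ := ((T.isL2Linear_gradient hΩ).comp J).exists_linear
    ((isL2Linear_smul hΩ hD (T.isL2Linear_gradient hΩ)).memLp ⟨θ, hθ⟩)
  have h : ∀ e, ∃ b : T.supgSpace u →ₗ[ℝ] ℝ, ∀ ψ, b ψ =
      ∫ x in T.elem e, δ e * π₂ * divDGrad Dθ θ x *
        inner ℝ (u x) (gradient (ψ : Plane → ℝ) x) := by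
    intro e
    obtain ⟨b, hb⟩ := ((T.isL2Linear_convection (u := u)).mono_measure
      (T.restrict_elem_le e)).exists_linear
      (((isL2Linear_divDGrad hD e).memLp ⟨θ, hθ⟩).const_mul (δ e * π₂))
    refine ⟨b, fun ψ => ?_⟩
    rw [hb]
    simp [mul_comm]
  choose b hb using h
  refine ⟨π₂ • b₀ + ∑ e, b e, fun ψ => ?_⟩
  simp [supgLoad, hb₀, hb, LinearMap.sum_apply, J]

/-! #### The stabilization terms -/

/-- The terms of the stabilization which are not controlled by their sign. -/
theorem abs_integral_lowerOrder_le (hΩ : IsOpen Ω) (hD : T.ElementwiseLipschitz D) (hε : 0 < ε)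
    (hπ₁ : 0 < π₁) {Cinv : ℝ} (hC : T.IsInverseConstant D Cinv) (hφ : φ ∈ T.P2Space)
    {e : Fin T.nel} (hδ0 : 0 ≤ δ e)
    (hδ : δ e ≤ min (1 / (2 * ε))
      (T.size e ^ 2 / (2 * π₁ * supNorm (T.elem e) D ^ 2 * Cinv ^ 2)))
    {g : Plane → ℝ} (hg : MemLp g 2 (volume.restrict (T.elem e))) :
    |∫ x in T.elem e, √(δ e) * (ε * φ x - π₁ * divDGrad D φ x) * g x| ≤
      (√(ε / 2 * ∫ x in T.elem e, φ x ^ 2) + √(π₁ / 2 * ∫ x in T.elem e, ‖gradient φ x‖ ^ 2)) *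
        √(∫ x in T.elem e, g x ^ 2) := by
  have hsz := T.size_pos e
  obtain ⟨hC0, hC⟩ := hC
  have hφL : MemLp φ 2 (volume.restrict (T.elem e)) :=
    ((piecewiseC1_of_mem_P2Space hφ).memLp hΩ).mono_measure (T.restrict_elem_le e)
  have hdL : MemLp (divDGrad D φ) 2 (volume.restrict (T.elem e)) :=
    (isL2Linear_divDGrad hD e).memLp ⟨φ, hφ⟩
  have h1 := abs_integral_mul_le (hφL.const_mul (√(δ e) * ε)) hg
  have h2 := abs_integral_mul_le (hdL.const_mul (√(δ e) * π₁)) hg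
  have hsplit : ∫ x in T.elem e, √(δ e) * (ε * φ x - π₁ * divDGrad D φ x) * g x =
      (∫ x in T.elem e, √(δ e) * ε * φ x * g x) -
        ∫ x in T.elem e, √(δ e) * π₁ * divDGrad D φ x * g x := by
    have hi1 : Integrable (fun x => √(δ e) * ε * φ x * g x) (volume.restrict (T.elem e)) :=
      (hφL.const_mul _).integrable_mul hg
    have hi2 : Integrable (fun x => √(δ e) * π₁ * divDGrad D φ x * g x)
        (volume.restrict (T.elem e)) := (hdL.const_mul _).integrable_mul hg
    rw [← integral_sub hi1 hi2]
    congr 1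
    funext x
    ring
  rw [hsplit, add_mul]
  refine (abs_sub _ _).trans (add_le_add (h1.trans ?_) (h2.trans ?_))
  · refine mul_le_mul_of_nonneg_right (Real.sqrt_le_sqrt ?_) (Real.sqrt_nonneg _)
    simp only [mul_pow, integral_const_mul, Real.sq_sqrt hδ0]
    refine mul_le_mul_of_nonneg_right ?_ (by positivity)
    have h3 := hδ.trans (min_le_left _ _)
    rw [le_div_iff₀ (by positivity)] at h3
    nlinarith
  · refine mul_le_mul_of_nonneg_right (Real.sqrt_le_sqrt ?_) (Real.sqrt_nonneg _)
    simp only [mul_pow, integral_const_mul, Real.sq_sqrt hδ0]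
    have hA0 : 0 ≤ ∫ x in T.elem e, ‖gradient φ x‖ ^ 2 := by positivity
    have h3 := hC φ hφ e
    have hn : 0 ≤ supNorm (T.elem e) D := ENNReal.toReal_nonneg
    rw [Real.sqrt_le_left (by positivity), mul_pow, Real.sq_sqrt hA0] at h3
    have h4 := hδ.trans (min_le_right _ _)
    set n := supNorm (T.elem e) D
    set A := ∫ x in T.elem e, ‖gradient φ x‖ ^ 2
    have h5 : δ e * π₁ * (Cinv / T.size e * n) ^ 2 ≤ 1 / 2 := by
      rcases hn.eq_or_lt with h0 | h0
      · rw [← h0]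
        norm_num
      · rw [le_div_iff₀ (by positivity)] at h4
        rw [div_mul_eq_mul_div, div_pow, mul_div_assoc', div_le_iff₀ (by positivity)]
        nlinarith
    calc δ e * π₁ ^ 2 * ∫ x in T.elem e, divDGrad D φ x ^ 2
        ≤ δ e * π₁ ^ 2 * ((Cinv / T.size e * n) ^ 2 * A) :=
          mul_le_mul_of_nonneg_left h3 (by positivity)
      _ = (δ e * π₁ * (Cinv / T.size e * n) ^ 2) * (π₁ * A) := by ring
      _ ≤ 1 / 2 * (π₁ * A) := mul_le_mul_of_nonneg_right h5 (by positivity)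
      _ = π₁ / 2 * A := by ring

theorem integral_stabilization_eq (hΩ : IsOpen Ω) (hD : T.ElementwiseLipschitz D)
    (hφ : φ ∈ T.supgSpace u) (hψ : ψ ∈ T.supgSpace u) {e : Fin T.nel} (hδ0 : 0 ≤ δ e) :
    ∫ x in T.elem e, δ e * (inner ℝ (u x) (gradient φ x) + ε * φ x - π₁ * divDGrad D φ x) *
        inner ℝ (u x) (gradient ψ x) =
      (∫ x in T.elem e, √(δ e) * inner ℝ (u x) (gradient φ x) *
        (√(δ e) * inner ℝ (u x) (gradient ψ x))) +
      ∫ x in T.elem e, √(δ e) * (ε * φ x - π₁ * divDGrad D φ x) *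
        (√(δ e) * inner ℝ (u x) (gradient ψ x)) := by
  have hle := T.restrict_elem_le e
  have hφL := ((piecewiseC1_of_mem_P2Space hφ.1).memLp hΩ).mono_measure hle
  have hdL : MemLp (divDGrad D φ) 2 (volume.restrict (T.elem e)) :=
    (isL2Linear_divDGrad hD e).memLp ⟨φ, hφ.1⟩
  rw [← integral_add]
  · congr 1
    funext x
    have := Real.mul_self_sqrt hδ0
    linear_combination (-(inner ℝ (u x) (gradient φ x) + ε * φ x - π₁ * divDGrad D φ x) *
        inner ℝ (u x) (gradient ψ x)) * this
  · exact ((hφ.2.mono_measure hle).const_mul _).integrable_mul ((hψ.2.mono_measure hle).const_mul _)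
  · exact (((hφL.const_mul ε).sub (hdL.const_mul π₁)).const_mul _).integrable_mul
      ((hψ.2.mono_measure hle).const_mul _)

theorem integral_eq_sum_of_mem_P2Space (hΩ : IsOpen Ω) (hφ : φ ∈ T.P2Space) :
    (∫ x in Ω, φ x ^ 2 = ∑ e, ∫ x in T.elem e, φ x ^ 2) ∧
      ∫ x in Ω, ‖gradient φ x‖ ^ 2 = ∑ e, ∫ x in T.elem e, ‖gradient φ x‖ ^ 2 := by
  have h := piecewiseC1_of_mem_P2Space hφ
  exact ⟨T.integral_eq_sum hΩ fun e =>
      (h.memLp hΩ).integrable_sq.mono_measure (T.restrict_elem_le e),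
    T.integral_eq_sum hΩ fun e =>
      (h.memLp_gradient hΩ).norm.integrable_sq.mono_measure (T.restrict_elem_le e)⟩

theorem half_sq_supgNorm_le_supgForm {G : Fin 2 → Plane → Plane} (hΩ : IsOpen Ω)
    (hu : IsVelocity Ω u G) (hD : T.ElementwiseLipschitz D)
    (h1 : ∀ᵐ x ∂(volume.restrict Ω), 1 ≤ D x) (hε : 0 < ε) (hπ₁ : 0 < π₁)
    {Cinv : ℝ} (hC : T.IsInverseConstant D Cinv) (hδ0 : ∀ e, 0 ≤ δ e)
    (hδ : ∀ e, δ e ≤ min (1 / (2 * ε))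
      (T.size e ^ 2 / (2 * π₁ * supNorm (T.elem e) D ^ 2 * Cinv ^ 2)))
    (hφ : φ ∈ T.supgSpace u) :
    1 / 2 * T.supgNorm u δ ε π₁ φ ^ 2 ≤ T.supgForm u D δ ε π₁ φ φ := by
  have hP := piecewiseC1_of_mem_P2Space hφ.1
  have hg := hP.memLp_gradient hΩ
  have hdiff : ∫ x in Ω, ‖gradient φ x‖ ^ 2 ≤
      ∫ x in Ω, D x * inner ℝ (gradient φ x) (gradient φ x) := by
    refine integral_mono_ae hg.norm.integrable_sq ?_ ?_
    · have := integrable_inner_of_memLp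
        ((isL2Linear_smul hΩ hD (T.isL2Linear_gradient hΩ)).memLp ⟨φ, hφ.1⟩) hg
      simpa only [real_inner_smul_left] using this
    · filter_upwards [h1] with x hx
      rw [real_inner_self_eq_norm_sq]
      exact le_mul_of_one_le_left (sq_nonneg _) hx
  have hstab : ∀ e, (∫ x in T.elem e, (√(δ e) * inner ℝ (u x) (gradient φ x)) ^ 2) / 2
      - ε / 2 * (∫ x in T.elem e, φ x ^ 2) - π₁ / 2 * (∫ x in T.elem e, ‖gradient φ x‖ ^ 2) ≤
      ∫ x in T.elem e, δ e * (inner ℝ (u x) (gradient φ x) + ε * φ x - π₁ * divDGrad D φ x) *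
        inner ℝ (u x) (gradient φ x) := by
    intro e
    rw [integral_stabilization_eq hΩ hD hφ hφ (hδ0 e)]
    have h2 := abs_integral_lowerOrder_le hΩ hD hε hπ₁ hC hφ.1 (hδ0 e) (hδ e)
      ((hφ.2.mono_measure (T.restrict_elem_le e)).const_mul √(δ e))
    have h3 := neg_le_of_abs_le h2
    simp only [← sq]
    have hB0 : 0 ≤ ε / 2 * ∫ x in T.elem e, φ x ^ 2 := by positivity
    have hA0 : 0 ≤ π₁ / 2 * ∫ x in T.elem e, ‖gradient φ x‖ ^ 2 := by positivity
    have hY0 : 0 ≤ ∫ x in T.elem e, (√(δ e) * inner ℝ (u x) (gradient φ x)) ^ 2 := by positivity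
    have hB := Real.sq_sqrt hB0
    have hA := Real.sq_sqrt hA0
    have hY := Real.sq_sqrt hY0
    nlinarith [sq_nonneg (√(ε / 2 * ∫ x in T.elem e, φ x ^ 2) -
        √(∫ x in T.elem e, (√(δ e) * inner ℝ (u x) (gradient φ x)) ^ 2) / 2),
      sq_nonneg (√(π₁ / 2 * ∫ x in T.elem e, ‖gradient φ x‖ ^ 2) -
        √(∫ x in T.elem e, (√(δ e) * inner ℝ (u x) (gradient φ x)) ^ 2) / 2)]
  have hsum := Finset.sum_le_sum fun e (_ : e ∈ Finset.univ) => hstab e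
  obtain ⟨hB, hA⟩ := integral_eq_sum_of_mem_P2Space hΩ hφ.1
  rw [Finset.sum_sub_distrib, Finset.sum_sub_distrib, ← Finset.mul_sum, ← Finset.mul_sum, ← hA,
    ← hB, ← Finset.sum_div] at hsum
  rw [sq_supgNorm hε.le hπ₁.le, supgForm, galerkinForm,
    hu.integral_convection_self_eq_zero hΩ hP]
  have hsq : ∫ x in Ω, φ x * φ x = ∫ x in Ω, φ x ^ 2 := by simp only [sq]
  rw [hsq]
  have := mul_le_mul_of_nonneg_left hdiff hπ₁.le
  linarith

theorem abs_stabilization_le (hΩ : IsOpen Ω) (hD : T.ElementwiseLipschitz D) (hε : 0 < ε)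
    (hπ₁ : 0 < π₁) {Cinv : ℝ} (hC : T.IsInverseConstant D Cinv) (hδ0 : ∀ e, 0 ≤ δ e)
    (hδ : ∀ e, δ e ≤ min (1 / (2 * ε))
      (T.size e ^ 2 / (2 * π₁ * supNorm (T.elem e) D ^ 2 * Cinv ^ 2)))
    (hφ : φ ∈ T.supgSpace u) (hψ : ψ ∈ T.supgSpace u) :
    |∑ e, ∫ x in T.elem e, δ e *
        (inner ℝ (u x) (gradient φ x) + ε * φ x - π₁ * divDGrad D φ x) *
        inner ℝ (u x) (gradient ψ x)| ≤
      2 * T.supgNorm u δ ε π₁ φ * T.supgNorm u δ ε π₁ ψ := by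
  set Y : (Plane → ℝ) → Fin T.nel → ℝ :=
    fun χ e => ∫ x in T.elem e, (√(δ e) * inner ℝ (u x) (gradient χ x)) ^ 2 with hYdef
  set n : Fin T.nel → ℝ := fun e => π₁ * (∫ x in T.elem e, ‖gradient φ x‖ ^ 2) +
    ε * (∫ x in T.elem e, φ x ^ 2) + Y φ e with hn
  have hY0 : ∀ χ e, 0 ≤ Y χ e := fun χ e => by positivity
  have hn0 : ∀ e, 0 ≤ n e := fun e => by positivity
  have hstab : ∀ e, |∫ x in T.elem e, δ e *
        (inner ℝ (u x) (gradient φ x) + ε * φ x - π₁ * divDGrad D φ x) *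
        inner ℝ (u x) (gradient ψ x)| ≤ 2 * (√(n e) * √(Y ψ e)) := by
    intro e
    have hle := T.restrict_elem_le e
    rw [integral_stabilization_eq hΩ hD hφ hψ (hδ0 e)]
    have h2 := abs_integral_lowerOrder_le hΩ hD hε hπ₁ hC hφ.1 (hδ0 e) (hδ e)
      ((hψ.2.mono_measure hle).const_mul √(δ e))
    have h3 := abs_integral_mul_le ((hφ.2.mono_measure hle).const_mul √(δ e))
      ((hψ.2.mono_measure hle).const_mul √(δ e))
    refine (abs_add_le _ _).trans ((add_le_add h3 h2).trans ?_)
    rw [← add_mul, ← mul_assoc]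
    refine mul_le_mul_of_nonneg_right ?_ (Real.sqrt_nonneg _)
    have hB0 : 0 ≤ ε / 2 * ∫ x in T.elem e, φ x ^ 2 := by positivity
    have hA0 : 0 ≤ π₁ / 2 * ∫ x in T.elem e, ‖gradient φ x‖ ^ 2 := by positivity
    have hB := Real.sq_sqrt hB0
    have hA := Real.sq_sqrt hA0
    have hY := Real.sq_sqrt (hY0 φ e)
    have hnn := Real.sq_sqrt (hn0 e)
    refine abs_le_of_sq_le_sq' ?_ (by positivity) |>.2
    have hne : n e = 2 * (π₁ / 2 * ∫ x in T.elem e, ‖gradient φ x‖ ^ 2) +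
        2 * (ε / 2 * ∫ x in T.elem e, φ x ^ 2) + Y φ e := by
      rw [hn]
      ring
    rw [mul_pow, hnn, hne]
    set a := √(π₁ / 2 * ∫ x in T.elem e, ‖gradient φ x‖ ^ 2)
    set b := √(ε / 2 * ∫ x in T.elem e, φ x ^ 2)
    set y := √(Y φ e)
    change (y + (b + a)) ^ 2 ≤ _
    nlinarith [sq_nonneg (y - b), sq_nonneg (y - a), sq_nonneg (b - a)]
  calc _ ≤ ∑ e, 2 * (√(n e) * √(Y ψ e)) :=
        (Finset.abs_sum_le_sum_abs _ _).trans (Finset.sum_le_sum fun e _ => hstab e)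
    _ = 2 * ∑ e, √(n e) * √(Y ψ e) := by rw [Finset.mul_sum]
    _ ≤ 2 * (√(∑ e, n e) * √(∑ e, Y ψ e)) :=
        mul_le_mul_of_nonneg_left (Real.sum_sqrt_mul_sqrt_le _ hn0 (hY0 ψ)) zero_le_two
    _ ≤ 2 * (T.supgNorm u δ ε π₁ φ * T.supgNorm u δ ε π₁ ψ) := by
        obtain ⟨hB, hA⟩ := integral_eq_sum_of_mem_P2Space hΩ hφ.1
        refine mul_le_mul_of_nonneg_left (mul_le_mul (Real.sqrt_le_sqrt (le_of_eq ?_))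
          (Real.sqrt_le_sqrt ?_) (Real.sqrt_nonneg _) (Real.sqrt_nonneg _)) zero_le_two
        · rw [hn, Finset.sum_add_distrib, Finset.sum_add_distrib, ← Finset.mul_sum,
            ← Finset.mul_sum, ← hA, ← hB]
        · exact le_add_of_nonneg_left (by positivity)
    _ = _ := by ring

/-! #### Continuity -/

theorem sqrt_integral_gradient_le_supgNorm (hε : 0 ≤ ε) (φ : Plane → ℝ) :
    √(π₁ * ∫ x in Ω, ‖gradient φ x‖ ^ 2) ≤ T.supgNorm u δ ε π₁ φ := by
  refine Real.sqrt_le_sqrt ?_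
  rw [add_assoc]
  exact le_add_of_nonneg_right (by positivity)

theorem sqrt_integral_le_supgNorm (hπ₁ : 0 ≤ π₁) (φ : Plane → ℝ) :
    √(ε * ∫ x in Ω, φ x ^ 2) ≤ T.supgNorm u δ ε π₁ φ := by
  refine Real.sqrt_le_sqrt ?_
  rw [add_right_comm]
  exact le_add_of_nonneg_left (by positivity)

theorem sqrt_H1_le_supgNorm (hε : 0 < ε) (hπ₁ : 0 < π₁) (φ : Plane → ℝ) :
    √((∫ x in Ω, ‖gradient φ x‖ ^ 2) + ∫ x in Ω, φ x ^ 2) ≤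
      √(1 / π₁ + 1 / ε) * T.supgNorm u δ ε π₁ φ := by
  have hA0 : 0 ≤ ∫ x in Ω, ‖gradient φ x‖ ^ 2 := by positivity
  have hB0 : 0 ≤ ∫ x in Ω, φ x ^ 2 := by positivity
  have hS0 : 0 ≤ ∑ e, ∫ x in T.elem e, (√(δ e) * inner ℝ (u x) (gradient φ x)) ^ 2 := by positivity
  rw [supgNorm, ← Real.sqrt_mul (by positivity)]
  refine Real.sqrt_le_sqrt ?_
  set A := ∫ x in Ω, ‖gradient φ x‖ ^ 2
  set B := ∫ x in Ω, φ x ^ 2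
  set S := ∑ e, ∫ x in T.elem e, (√(δ e) * inner ℝ (u x) (gradient φ x)) ^ 2
  have h : (1 / π₁ + 1 / ε) * (π₁ * A + ε * B + S) =
      A + B + (ε * B / π₁ + π₁ * A / ε + (1 / π₁ + 1 / ε) * S) := by
    field_simp
    ring
  rw [h]
  exact le_add_of_nonneg_right (by positivity)

theorem abs_supgForm_le {G : Fin 2 → Plane → Plane} {Dmax U : ℝ} (hΩ : IsOpen Ω)
    (hu : IsVelocity Ω u G) (hU : velocityNorm Ω u G ≤ U) (hD : T.ElementwiseLipschitz D)
    (hDmax : supNorm Ω D ≤ Dmax) (hε : 0 < ε) (hπ₁ : 0 < π₁)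
    {Cinv : ℝ} (hC : T.IsInverseConstant D Cinv) (hδ0 : ∀ e, 0 ≤ δ e)
    (hδ : ∀ e, δ e ≤ min (1 / (2 * ε))
      (T.size e ^ 2 / (2 * π₁ * supNorm (T.elem e) D ^ 2 * Cinv ^ 2)))
    (hφ : φ ∈ T.supgSpace u) (hψ : ψ ∈ T.supgSpace u) :
    |T.supgForm u D δ ε π₁ φ ψ| ≤ (2 * |U| * (1 / π₁ + 1 / ε) + |Dmax| + 3) *
      T.supgNorm u δ ε π₁ φ * T.supgNorm u δ ε π₁ ψ := by
  have hPφ := piecewiseC1_of_mem_P2Space hφ.1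
  have hPψ := piecewiseC1_of_mem_P2Space hψ.1
  have hgφ := hPφ.memLp_gradient hΩ
  have hgψ := hPψ.memLp_gradient hΩ
  set Nφ := T.supgNorm u δ ε π₁ φ
  set Nψ := T.supgNorm u δ ε π₁ ψ
  have hNφ : 0 ≤ Nφ := supgNorm_nonneg φ
  have hNψ : 0 ≤ Nψ := supgNorm_nonneg ψ
  have hconv : |∫ x in Ω, inner ℝ (u x) (gradient φ x) * ψ x| ≤
      2 * |U| * (1 / π₁ + 1 / ε) * Nφ * Nψ := by
    refine (hu.abs_integral_convection_le hΩ hPψ hgφ).trans ?_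
    have hc0 : 0 ≤ 1 / π₁ + 1 / ε := by positivity
    have h1 : √(∫ x in Ω, ‖gradient φ x‖ ^ 2) ≤ √(1 / π₁ + 1 / ε) * Nφ :=
      (Real.sqrt_le_sqrt (le_add_of_nonneg_right (by positivity))).trans
        (sqrt_H1_le_supgNorm hε hπ₁ φ)
    have h2 : velocityNorm Ω u G ≤ |U| := hU.trans (le_abs_self U)
    have h3 : 0 ≤ velocityNorm Ω u G := Real.sqrt_nonneg _
    calc _ ≤ 2 * |U| * (√(1 / π₁ + 1 / ε) * Nψ) * (√(1 / π₁ + 1 / ε) * Nφ) := by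
          gcongr
          exact sqrt_H1_le_supgNorm hε hπ₁ ψ
      _ = 2 * |U| * (√(1 / π₁ + 1 / ε) * √(1 / π₁ + 1 / ε)) * Nφ * Nψ := by ring
      _ = _ := by rw [Real.mul_self_sqrt hc0]
  have hdiff : |π₁ * ∫ x in Ω, D x * inner ℝ (gradient φ x) (gradient ψ x)| ≤
      |Dmax| * Nφ * Nψ := by
    have hsm : MemLp (fun x => D x • gradient φ x) 2 (volume.restrict Ω) :=
      (isL2Linear_smul hΩ hD (T.isL2Linear_gradient hΩ)).memLp ⟨φ, hφ.1⟩
    have h1 := abs_integral_inner_le hsm hgψ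
    simp only [real_inner_smul_left] at h1
    have h2 : √(∫ x in Ω, ‖D x • gradient φ x‖ ^ 2) ≤
        |Dmax| * √(∫ x in Ω, ‖gradient φ x‖ ^ 2) := by
      rw [← Real.sqrt_sq (abs_nonneg Dmax), ← Real.sqrt_mul (sq_nonneg _), ← integral_const_mul]
      refine Real.sqrt_le_sqrt (integral_mono_ae hsm.norm.integrable_sq
        (hgφ.norm.integrable_sq.const_mul _) ?_)
      filter_upwards [hD.ae_abs_le_supNorm hΩ] with x hx
      rw [norm_smul, mul_pow]
      exact mul_le_mul_of_nonneg_right (pow_le_pow_left₀ (norm_nonneg _)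
        (hx.trans (hDmax.trans (le_abs_self _))) 2) (sq_nonneg _)
    rw [abs_mul, abs_of_pos hπ₁]
    calc π₁ * |∫ x in Ω, D x * inner ℝ (gradient φ x) (gradient ψ x)|
        ≤ π₁ * (|Dmax| * √(∫ x in Ω, ‖gradient φ x‖ ^ 2) *
            √(∫ x in Ω, ‖gradient ψ x‖ ^ 2)) :=
          mul_le_mul_of_nonneg_left
            (h1.trans (mul_le_mul_of_nonneg_right h2 (Real.sqrt_nonneg _))) hπ₁.le
      _ = |Dmax| * (√(π₁ * ∫ x in Ω, ‖gradient φ x‖ ^ 2) *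
            √(π₁ * ∫ x in Ω, ‖gradient ψ x‖ ^ 2)) := by
          rw [Real.sqrt_mul hπ₁.le, Real.sqrt_mul hπ₁.le]
          nth_rewrite 1 [← Real.mul_self_sqrt hπ₁.le]
          ring
      _ ≤ |Dmax| * (Nφ * Nψ) :=
          mul_le_mul_of_nonneg_left (mul_le_mul (sqrt_integral_gradient_le_supgNorm hε.le φ)
            (sqrt_integral_gradient_le_supgNorm hε.le ψ) (Real.sqrt_nonneg _) hNφ) (abs_nonneg _)
      _ = _ := by ring
  have hmass : |ε * ∫ x in Ω, φ x * ψ x| ≤ Nφ * Nψ := by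
    rw [abs_mul, abs_of_pos hε]
    calc ε * |∫ x in Ω, φ x * ψ x|
        ≤ ε * (√(∫ x in Ω, φ x ^ 2) * √(∫ x in Ω, ψ x ^ 2)) :=
          mul_le_mul_of_nonneg_left (abs_integral_mul_le (hPφ.memLp hΩ) (hPψ.memLp hΩ)) hε.le
      _ = √(ε * ∫ x in Ω, φ x ^ 2) * √(ε * ∫ x in Ω, ψ x ^ 2) := by
          rw [Real.sqrt_mul hε.le, Real.sqrt_mul hε.le]
          nth_rewrite 1 [← Real.mul_self_sqrt hε.le]
          ring
      _ ≤ Nφ * Nψ := mul_le_mul (sqrt_integral_le_supgNorm hπ₁.le φ)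
          (sqrt_integral_le_supgNorm hπ₁.le ψ) (Real.sqrt_nonneg _) hNφ
  have hstab := abs_stabilization_le hΩ hD hε hπ₁ hC hδ0 hδ hφ hψ
  rw [supgForm, galerkinForm]
  calc _ ≤ 2 * |U| * (1 / π₁ + 1 / ε) * Nφ * Nψ + |Dmax| * Nφ * Nψ + Nφ * Nψ + 2 * Nφ * Nψ :=
        (abs_add_le _ _).trans (add_le_add ((abs_add_le _ _).trans (add_le_add
          ((abs_add_le _ _).trans (add_le_add hconv hdiff)) hmass)) hstab)
    _ = _ := by ring

end Triangulation

/-- A bilinear form on a finite-dimensional space which vanishes on the diagonal only at zero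
represents every linear form uniquely. -/
theorem LinearMap.existsUnique_forall_eq_of_definite {V : Type*} [AddCommGroup V] [Module ℝ V]
    [FiniteDimensional ℝ V] (a : V →ₗ[ℝ] V →ₗ[ℝ] ℝ) (ha : ∀ v, a v v = 0 → v = 0)
    (l : V →ₗ[ℝ] ℝ) : ∃! v, ∀ w, a v w = l w := by
  have hinj : Function.Injective a := by
    rw [injective_iff_map_eq_zero]
    exact fun v hv => ha v (by rw [hv]; rfl)
  have hsurj : Function.Surjective a :=
    (LinearMap.injective_iff_surjective_of_finrank_eq_finrank
      (Subspace.dual_finrank_eq (K := ℝ) (V := V)).symm).1 hinj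
  obtain ⟨v, hv⟩ := hsurj l
  exact ⟨v, fun w => by rw [hv], fun v' hv' => hinj (by rw [hv]; exact LinearMap.ext hv')⟩

theorem mainTheorem2 (ε π₁ Dmax U : ℝ) (hε : 0 < ε) (hπ₁ : 0 < π₁) :
    ∃ C : ℝ, 0 < C ∧
      ∀ (Ω : Set Plane) (_ : IsOpen Ω)
        (u : Plane → Plane) (G : Fin 2 → Plane → Plane)
        (_ : IsVelocity Ω u G) (_ : velocityNorm Ω u G ≤ U)
        (T : Triangulation Ω)
        (D : Plane → ℝ) (_ : T.ElementwiseLipschitz D)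
        (_ : ∀ᵐ x ∂(volume.restrict Ω), 1 ≤ D x) (_ : supNorm Ω D ≤ Dmax),
        (∃ Cinv : ℝ, T.IsInverseConstant D Cinv) ∧
        ∀ (Cinv : ℝ) (_ : T.IsInverseConstant D Cinv)
          (δ : Fin T.nel → ℝ) (_ : ∀ e, 0 ≤ δ e)
          (_ : ∀ e, δ e ≤ min (1 / (2 * ε))
            (T.size e ^ 2 / (2 * π₁ * supNorm (T.elem e) D ^ 2 * Cinv ^ 2))),
          -- the form is bilinear on `V_h`
          (∃ a : T.supgSpace u →ₗ[ℝ] T.supgSpace u →ₗ[ℝ] ℝ,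
            ∀ φ ψ, a φ ψ = T.supgForm u D δ ε π₁ φ ψ) ∧
          -- coercivity
          (∀ φ ∈ T.supgSpace u,
            1 / 2 * T.supgNorm u δ ε π₁ φ ^ 2 ≤ T.supgForm u D δ ε π₁ φ φ) ∧
          -- continuity
          (∀ φ ∈ T.supgSpace u, ∀ ψ ∈ T.supgSpace u,
            |T.supgForm u D δ ε π₁ φ ψ| ≤
              C * T.supgNorm u δ ε π₁ φ * T.supgNorm u δ ε π₁ ψ) ∧
          -- well-posedness for every linear functional on `V_h`
          (∀ l : T.supgSpace u →ₗ[ℝ] ℝ,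
            (∃! φ : T.supgSpace u, ∀ ψ : T.supgSpace u, T.supgForm u D δ ε π₁ φ ψ = l ψ) ∧
            (∃ M : ℝ, 0 ≤ M ∧ ∀ ψ : T.supgSpace u, |l ψ| ≤ M * T.supgNorm u δ ε π₁ ψ) ∧
            ∀ (φ : T.supgSpace u) (M : ℝ), 0 ≤ M →
              (∀ ψ : T.supgSpace u, T.supgForm u D δ ε π₁ φ ψ = l ψ) →
              (∀ ψ : T.supgSpace u, |l ψ| ≤ M * T.supgNorm u δ ε π₁ ψ) →
              T.supgNorm u δ ε π₁ φ ≤ 2 * M) ∧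
          -- the stabilized discrete nanoparticle problem is one of these problems
          (∀ (π₂ : ℝ) (Dθ θ : Plane → ℝ), T.ElementwiseLipschitz Dθ → θ ∈ T.P2Space →
            (∃ b : T.supgSpace u →ₗ[ℝ] ℝ, ∀ ψ, b ψ = T.supgLoad u Dθ θ δ π₂ ψ) ∧
            ∃! φ : T.supgSpace u, ∀ ψ : T.supgSpace u,
              T.supgForm u D δ ε π₁ φ ψ = T.supgLoad u Dθ θ δ π₂ ψ) := by
  refine ⟨2 * |U| * (1 / π₁ + 1 / ε) + |Dmax| + 3, by positivity, ?_⟩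
  intro Ω hΩ u G hu hU T D hD h1 hDmax
  refine ⟨T.exists_isInverseConstant hD hΩ h1, ?_⟩
  intro Cinv hC δ hδ0 hδ
  have := T.finiteDimensional_supgSpace u
  obtain ⟨a, ha⟩ := T.exists_bilin_supgForm (u := u) (δ := δ) (ε := ε) (π₁ := π₁) hΩ hD
  have hcoer : ∀ φ ∈ T.supgSpace u,
      1 / 2 * T.supgNorm u δ ε π₁ φ ^ 2 ≤ T.supgForm u D δ ε π₁ φ φ := fun φ hφ =>
    T.half_sq_supgNorm_le_supgForm hΩ hu hD h1 hε hπ₁ hC hδ0 hδ hφ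
  have hcont : ∀ φ ∈ T.supgSpace u, ∀ ψ ∈ T.supgSpace u, |T.supgForm u D δ ε π₁ φ ψ| ≤
      (2 * |U| * (1 / π₁ + 1 / ε) + |Dmax| + 3) *
        T.supgNorm u δ ε π₁ φ * T.supgNorm u δ ε π₁ ψ := fun φ hφ ψ hψ =>
    T.abs_supgForm_le hΩ hu hU hD hDmax hε hπ₁ hC hδ0 hδ hφ hψ
  have hdef : ∀ φ, a φ φ = 0 → φ = 0 := by
    intro φ h
    have h2 := hcoer φ φ.2
    rw [← ha, h] at h2
    have h3 : T.supgNorm u δ ε π₁ φ = 0 :=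
      pow_eq_zero_iff two_ne_zero |>.1 (le_antisymm (by linarith) (sq_nonneg _))
    exact Subtype.ext (T.eq_zero_of_supgNorm_eq_zero hΩ hε hπ₁.le φ.2.1 h3)
  have hex : ∀ l : T.supgSpace u →ₗ[ℝ] ℝ, ∃! φ : T.supgSpace u,
      ∀ ψ : T.supgSpace u, T.supgForm u D δ ε π₁ φ ψ = l ψ := by
    intro l
    simpa only [ha] using a.existsUnique_forall_eq_of_definite hdef l
  refine ⟨⟨a, ha⟩, hcoer, hcont, fun l => ⟨hex l, ?_, ?_⟩, ?_⟩
  · obtain ⟨φ, hφ, -⟩ := hex l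
    refine ⟨(2 * |U| * (1 / π₁ + 1 / ε) + |Dmax| + 3) * T.supgNorm u δ ε π₁ φ,
      mul_nonneg (by positivity) (T.supgNorm_nonneg _), fun ψ => ?_⟩
    rw [← hφ ψ]
    exact hcont φ φ.2 ψ ψ.2
  · intro φ M hM hφ hl
    have h2 := hcoer φ φ.2
    rw [hφ φ] at h2
    have h3 := (le_abs_self _).trans (hl φ)
    have hN : 0 ≤ T.supgNorm u δ ε π₁ φ := T.supgNorm_nonneg _
    by_contra! hlt
    nlinarith
  · intro π₂ Dθ θ hDθ hθ
    obtain ⟨b, hb⟩ := T.exists_linear_supgLoad (u := u) (δ := δ) hΩ hDθ hθ π₂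
    refine ⟨⟨b, hb⟩, ?_⟩
    simpa only [hb] using hex b
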